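/- Let $k$ be a field (of any characteristic). A Hurwitz algebra over $k$ is a non-zero, finite-dimensional, unital, not necessarily associative $k$-algebra $A$ with a quadratic form $n:A\to k$ such that $n(ab)=n(a)n(b)$ for all $a,b\in A$ and such that the polar form $\langle x,y\rangle=n(x+y)-n(x)-n(y)$ is non-degenerate ($\langle x,A\rangle=0$ only if $x=0$). Let $A=(A,n)$ be a Hurwitz algebra. *Isotopes.* For $\alpha,\beta\in GL(A)$ the principal isotope $A_{\alpha,\beta}$ is the vector space $A$ with the multiplication $x\circ y=\alpha(x)\beta(y)$. Let $\check{\mathscr I}(A)$ be the groupoid whose objects are the principal isotopes of $A$ (two isotopes being equal if their multiplications are) and whose morphisms are the algebra isomorphisms between them. *Groups.* A similitude of $A$ with multiplier $\mu\in k^*$ is a map $\varphi\in GL(A)$ with $n(\varphi(x))=\mu\, n(x)$ for all $x$; these maps form the group $GO(A)$. If $\operatorname{char}k\ne2$, a similitude $\varphi$ with multiplier $\mu$ is proper if $\det\varphi=\mu^{\dim A/2}$; if $\operatorname{char}k=2$, it is proper if its Dickson invariant $\operatorname{tr}(\ell(\varphi\ell\varphi^{-1}-\ell))$ is zero, where $\ell$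 is any endomorphism of $A$ with $\langle\ell x,x\rangle=n(x)$ for all $x$. Let $GO^+(A)$ be the group of proper similitudes, $G(A)=GO(A)$ if $\dim A\le2$ and $G(A)=GO^+(A)$ if $\dim A\ge4$ (every Hurwitz algebra has dimension $1$, $2$, $4$ or $8$), and put $PG(A)=G(A)/k^*\mathbb I$ and $PGL(A)=GL(A)/k^*\mathbb I$. Triality components of $\varphi$ are $\varphi_1,\varphi_2\in GO(A)$ with $\varphi(xy)=\varphi_1(x)\varphi_2(y)$ for all $x,y\in A$. *The action.* Let $N(A)$ be the nucleus of $A$, i.e. the set of all $a\in A$ such that $(xy)z=x(yz)$ whenever $a\in\{x,y,z\}$, and let $N(A)^*$ be its group of invertible elements. With $L_w(x)=wx$ and $R_w(x)=xw$, let $X_A=PGL(A)^2/N(A)^*$ be the orbit set of the action $w\cdot(\alpha,\beta)=(R_w^{-1}\alpha,L_w\beta)$. **Theorem.** Every $\varphi\in G(A)$ has triality components, and $$\varphi\cdot(\alpha,\beta)=(\varphi_1\alpha\varphi^{-1},\varphi_2\beta\varphi^{-1}),$$ where $\varphi_1,\varphi_2$ are any triality components of $\varphi$, is a well-defined action of the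 group $PG(A)$ on $X_A$. Let $\mathscr X(A)$ be the groupoid of this action: its objects are the elements of $X_A$, and its morphisms $x\to y$ are the $g\in PG(A)$ with $g\cdot x=y$. Then the categories $\check{\mathscr I}(A)$ and $\mathscr X(A)$ are equivalent. More precisely, every isomorphism between principal isotopes of $A$ lies in $G(A)$, and sending $A_{\alpha,\beta}$ to the class of $(\alpha,\beta)$ in $X_A$ and an isomorphism $\varphi$ to the class of $\varphi$ in $PG(A)$ is a well-defined functor $\mathscr F_A:\check{\mathscr I}(A)\to\mathscr X(A)$ that is an equivalence of categories. -/

import Mathlib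

open CategoryTheory

set_option linter.unusedSectionVars false

noncomputable section

namespace HurwitzIsotope

universe u v

/-! ### Quadratic spaces and similitudes -/

section Quadratic

variable {k : Type u} {V : Type v} [Field k] [AddCommGroup V] [Module k V]

/-- The quadratic form `q` is non-degenerate: its polar form has trivial radical. -/
def NonDegenerate (q : QuadraticForm k V) : Prop :=
  ∀ x : V, (∀ y : V, QuadraticMap.polar q x y = 0) → x = 0

/-- The linear automorphism `φ` is a similitude of `q` with multiplier `m`. -/
def HasMultiplier (q : QuadraticForm k V) (φ : V ≃ₗ[k] V) (m : kˣ) : Prop :=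
  ∀ x : V, q (φ x) = (m : k) * q x

theorem HasMultiplier.mul {q : QuadraticForm k V} {φ ψ : V ≃ₗ[k] V} {m m' : kˣ}
    (h : HasMultiplier q φ m) (h' : HasMultiplier q ψ m') :
    HasMultiplier q (φ * ψ) (m * m') := by
  intro x
  rw [LinearEquiv.mul_apply, h, h', Units.val_mul, mul_assoc]

theorem HasMultiplier.one (q : QuadraticForm k V) : HasMultiplier q 1 1 := by
  intro x
  simp

theorem HasMultiplier.inv {q : QuadraticForm k V} {φ : V ≃ₗ[k] V} {m : kˣ}
    (h : HasMultiplier q φ m) : HasMultiplier q φ⁻¹ m⁻¹ := by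
  intro x
  have h1 : φ (φ⁻¹ x) = x := φ.apply_symm_apply x
  have h2 := h (φ⁻¹ x)
  rw [h1] at h2
  rw [h2, Units.inv_mul_cancel_left]

/-- The group `GO(V, q)` of similitudes. -/
def GO (q : QuadraticForm k V) : Subgroup (V ≃ₗ[k] V) where
  carrier := {φ | ∃ m : kˣ, HasMultiplier q φ m}
  mul_mem' := by
    rintro _ _ ⟨m, h⟩ ⟨m', h'⟩
    exact ⟨_, h.mul h'⟩
  one_mem' := ⟨1, HasMultiplier.one q⟩
  inv_mem' := by
    rintro _ ⟨m, h⟩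
    exact ⟨_, h.inv⟩

/-- The endomorphism `l` satisfies `⟨l x, x⟩ = q x` for all `x`. In characteristic two this says
that `s ↦ tr (l s)` is the linear form on the space of self-adjoint endomorphisms (for the polar
form) that belongs to `q`, i.e. the one taking the value `q v` at `x ↦ ⟨v, x⟩ v`. -/
def Represents (q : QuadraticForm k V) (l : Module.End k V) : Prop :=
  ∀ x : V, QuadraticMap.polar q (l x) x = q x

/-- The Dickson invariant `tr (l (φ l φ⁻¹ - l))` of a similitude `φ` of a non-degenerate form `q`
in characteristic two, computed with an endomorphism `l` representing `q`; it takes the values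
`0` and `1` and does not depend on the choice of `l`. -/
def dickson (l : Module.End k V) (φ : V ≃ₗ[k] V) : k :=
  LinearMap.trace k V
    (l * ((φ : V →ₗ[k] V) * l * ((φ⁻¹ : V ≃ₗ[k] V) : V →ₗ[k] V) - l))

/-- The similitude `φ` with multiplier `m` is proper: if `2 ≠ 0` in `k` this means
`det φ = m ^ (dim V / 2)`, and if `2 = 0` in `k` it means that the Dickson invariant vanishes. -/
def ProperWith (q : QuadraticForm k V) (φ : V ≃ₗ[k] V) (m : kˣ) : Prop :=
  ((2 : k) ≠ 0 → LinearMap.det (φ : V →ₗ[k] V) = (m : k) ^ (Module.finrank k V / 2)) ∧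
  ((2 : k) = 0 → ∀ l : Module.End k V, Represents q l → dickson l φ = 0)

theorem matrix_trace_zero {ι : Type*} [Fintype ι] (h2 : (2 : k) = 0) (C T : Matrix ι ι k)
    (hC : C.transpose = C) (hT : T.transpose = T) (hT0 : ∀ i, T i i = 0) :
    (C * T).trace = 0 := by
  classical
  simp only [Matrix.trace, Matrix.diag, Matrix.mul_apply]
  rw [← Finset.sum_product']
  have hC' : ∀ i j, C i j = C j i := fun i j => congrFun (congrFun hC.symm i) j
  have hT' : ∀ i j, T i j = T j i := fun i j => congrFun (congrFun hT.symm i) j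
  refine Finset.sum_involution (fun p _ => (p.2, p.1)) ?_ ?_ ?_ ?_
  · rintro ⟨i, j⟩ _
    simp only
    rw [hC' j i, hT' i j, ← two_mul, h2, zero_mul]
  · rintro ⟨i, j⟩ _ hne heq
    simp only [Prod.mk.injEq] at heq
    obtain ⟨rfl, _⟩ := heq
    exact hne (by simp [hT0])
  · intro a ha
    simp
  · intro a ha
    rfl

theorem trace_alternating_mul [FiniteDimensional k V] {q : QuadraticForm k V}
    (hq : NonDegenerate q) (h2 : (2 : k) = 0) (s t : Module.End k V)
    (hs : ∀ x, QuadraticMap.polar q (s x) x = 0) (ht : ∀ x, QuadraticMap.polar q (t x) x = 0) :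
    LinearMap.trace k V (s * t) = 0 := by
  classical
  have hneg : ∀ a b : k, a + b = 0 → a = b := by
    intro a b hab
    linear_combination hab - b * h2
  let e := Module.finBasis k V
  let b : LinearMap.BilinForm k V := q.polarBilin
  have hb : ∀ x y, b x y = QuadraticMap.polar q x y := fun x y => rfl
  have hbs : ∀ x y, b x y = b y x := fun x y => QuadraticMap.polar_comm q x y
  have hnd : b.Nondegenerate := by
    refine ⟨fun x hx => hq x hx, fun y hy => hq y fun x => ?_⟩
    have := hy x
    rw [hbs] at this
    exact this
  have hsym : ∀ r : Module.End k V, (∀ x, QuadraticMap.polar q (r x) x = 0) →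
      ∀ x y, b (r x) y = b (r y) x := by
    intro r hr x y
    apply hneg
    have h1 : b (r (x + y)) (x + y) = 0 := hr (x + y)
    have h2 : b (r x) x = 0 := hr x
    have h3 : b (r y) y = 0 := hr y
    simp only [map_add, LinearMap.add_apply, h2, h3] at h1
    linear_combination h1
  let B := LinearMap.BilinForm.toMatrix e b
  have hBdet : IsUnit B.det :=
    isUnit_iff_ne_zero.mpr ((LinearMap.BilinForm.nondegenerate_iff_det_ne_zero e).mp hnd)
  have hBt : B.transpose = B := by
    ext i j
    simp [B, Matrix.transpose_apply, hbs (e j) (e i)]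
  have key : ∀ r : Module.End k V, (∀ x, QuadraticMap.polar q (r x) x = 0) →
      ∃ S : Matrix _ _ k, S.transpose = S ∧ (∀ i, S i i = 0) ∧
        LinearMap.toMatrix e e r = B⁻¹ * S := by
    intro r hr
    have hS : ∀ i j, (B * LinearMap.toMatrix e e r) i j = b (e i) (r (e j)) := by
      intro i j
      have h := congrFun (congrFun (LinearMap.BilinForm.toMatrix_compRight e b r) i) j
      rw [LinearMap.BilinForm.toMatrix_apply] at h
      exact h.symm
    refine ⟨B * LinearMap.toMatrix e e r, ?_, ?_, ?_⟩
    · ext i j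
      rw [Matrix.transpose_apply, hS, hS, hbs, hsym r hr, hbs]
    · intro i
      rw [hS, hbs]
      exact hr _
    · rw [Matrix.nonsing_inv_mul_cancel_left _ _ hBdet]
  obtain ⟨S, hS, -, hsS⟩ := key s hs
  obtain ⟨T, hT, hT0, htT⟩ := key t ht
  have hBi : B⁻¹.transpose = B⁻¹ := by
    rw [Matrix.transpose_nonsing_inv, hBt]
  rw [LinearMap.trace_eq_matrix_trace k e, LinearMap.toMatrix_mul, hsS, htT, ← Matrix.mul_assoc]
  refine matrix_trace_zero h2 _ _ ?_ hT hT0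
  rw [Matrix.transpose_mul, Matrix.transpose_mul, hBi, hS, Matrix.mul_assoc]

/-- The endomorphism `φ l φ⁻¹`. -/
def conj (φ : V ≃ₗ[k] V) (l : Module.End k V) : Module.End k V :=
  (φ : V →ₗ[k] V) * l * ((φ⁻¹ : V ≃ₗ[k] V) : V →ₗ[k] V)

theorem represents_conj {q : QuadraticForm k V} {φ : V ≃ₗ[k] V} {m : kˣ}
    (h : HasMultiplier q φ m) {l : Module.End k V} (hl : Represents q l) :
    Represents q (conj φ l) := by
  intro x
  have h1 : φ (φ⁻¹ x) = x := φ.apply_symm_apply x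
  have hp : ∀ a b, QuadraticMap.polar q (φ a) (φ b) = (m : k) * QuadraticMap.polar q a b := by
    intro a b
    simp only [QuadraticMap.polar, ← map_add, h a, h b, h (a + b)]
    ring
  have h3 : conj φ l x = φ (l (φ⁻¹ x)) := rfl
  have h4 := hp (l (φ⁻¹ x)) (φ⁻¹ x)
  rw [h1, hl, ← h, h1] at h4
  rw [h3, h4]

theorem conj_mul (φ ψ : V ≃ₗ[k] V) (l : Module.End k V) :
    conj (φ * ψ) l = conj φ (conj ψ l) := by
  rw [conj, conj, conj, mul_inv_rev]
  rfl

theorem conj_inv_conj (φ : V ≃ₗ[k] V) (l : Module.End k V) : conj φ (conj φ⁻¹ l) = l := by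
  rw [← conj_mul, mul_inv_cancel]
  rfl

theorem conj_sub (φ : V ≃ₗ[k] V) (l l' : Module.End k V) :
    conj φ (l - l') = conj φ l - conj φ l' := by
  simp only [conj, mul_sub, sub_mul]

theorem trace_conj_mul (φ : V ≃ₗ[k] V) (l s : Module.End k V) :
    LinearMap.trace k V (l * conj φ s) = LinearMap.trace k V (conj φ⁻¹ l * s) := by
  simp only [conj, inv_inv]
  rw [← mul_assoc, LinearMap.trace_mul_comm]
  simp only [mul_assoc]

theorem Represents.sub_alternating {q : QuadraticForm k V} {l l' : Module.End k V}
    (hl : Represents q l) (hl' : Represents q l') (x : V) :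
    QuadraticMap.polar q ((l - l') x) x = 0 := by
  have h := congrFun (congrArg DFunLike.coe (map_sub q.polarBilin (l x) (l' x))) x
  rw [LinearMap.sub_apply]
  refine h.trans ?_
  have h1 : q.polarBilin (l x) x = q x := hl x
  have h2 : q.polarBilin (l' x) x = q x := hl' x
  rw [LinearMap.sub_apply, h1, h2, sub_self]

theorem dickson_mul [FiniteDimensional k V] {q : QuadraticForm k V} (hq : NonDegenerate q)
    (h2 : (2 : k) = 0) {l : Module.End k V} (hl : Represents q l) {φ ψ : V ≃ₗ[k] V} {m m' : kˣ}
    (hφ : HasMultiplier q φ m) (hψ : HasMultiplier q ψ m') :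
    dickson l (φ * ψ) = dickson l φ + dickson l ψ := by
  have e1 : ∀ χ : V ≃ₗ[k] V, dickson l χ = LinearMap.trace k V (l * (conj χ l - l)) :=
    fun χ => rfl
  have e2 : l * (conj (φ * ψ) l - l) =
      l * conj φ (conj ψ l - l) + l * (conj φ l - l) := by
    rw [conj_sub, conj_mul, ← mul_add]
    congr 1
    abel
  have e3 : conj φ⁻¹ l * (conj ψ l - l) =
      (conj φ⁻¹ l - l) * (conj ψ l - l) + l * (conj ψ l - l) := by
    rw [sub_mul, sub_add_cancel]
  rw [e1, e1, e1, e2, map_add, trace_conj_mul, e3, map_add,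
    trace_alternating_mul hq h2 _ _
      ((represents_conj hφ.inv hl).sub_alternating hl)
      ((represents_conj hψ hl).sub_alternating hl), zero_add, add_comm]

theorem dickson_one (l : Module.End k V) : dickson l (1 : V ≃ₗ[k] V) = 0 := by
  have : l * (conj (1 : V ≃ₗ[k] V) l - l) = 0 := by
    have : conj (1 : V ≃ₗ[k] V) l = l := rfl
    rw [this, sub_self, mul_zero]
  exact (congrArg (LinearMap.trace k V) this).trans (map_zero _)

/-- The group `GO⁺(V, q)` of proper similitudes of a non-degenerate quadratic space. -/
def GOplus [FiniteDimensional k V] (q : QuadraticForm k V) (hq : NonDegenerate q) :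
    Subgroup (V ≃ₗ[k] V) where
  carrier := {φ | ∃ m : kˣ, HasMultiplier q φ m ∧ ProperWith q φ m}
  mul_mem' := by
    rintro φ ψ ⟨m, h, hd, hD⟩ ⟨m', h', hd', hD'⟩
    refine ⟨m * m', h.mul h', fun h2 => ?_, fun h2 l hl => ?_⟩
    · have e : ((φ * ψ : V ≃ₗ[k] V) : V →ₗ[k] V) = (φ : V →ₗ[k] V) * (ψ : V →ₗ[k] V) := rfl
      rw [e, map_mul, hd h2, hd' h2, Units.val_mul, mul_pow]
    · rw [dickson_mul hq h2 hl h h', hD h2 l hl, hD' h2 l hl, add_zero]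
  one_mem' := by
    refine ⟨1, HasMultiplier.one q, fun _ => ?_, fun _ l _ => dickson_one l⟩
    have e : ((1 : V ≃ₗ[k] V) : V →ₗ[k] V) = 1 := rfl
    rw [e, map_one, Units.val_one, one_pow]
  inv_mem' := by
    rintro φ ⟨m, h, hd, hD⟩
    refine ⟨m⁻¹, h.inv, fun h2 => ?_, fun h2 l hl => ?_⟩
    · have e : ((φ⁻¹ : V ≃ₗ[k] V) : V →ₗ[k] V) * (φ : V →ₗ[k] V) = 1 := by
        ext x
        exact φ.symm_apply_apply x
      have e' := congrArg LinearMap.det e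
      rw [map_mul, map_one, hd h2] at e'
      rw [eq_inv_of_mul_eq_one_left e', Units.val_inv_eq_inv_val, inv_pow]
    · have e := dickson_mul hq h2 hl h h.inv
      rw [mul_inv_cancel, dickson_one, hD h2 l hl, zero_add] at e
      exact e.symm

end Quadratic

/-! ### Projective groups -/

section Projective

variable (k : Type u) (V : Type v) [Field k] [AddCommGroup V] [Module k V]

/-- The subgroup `k* I` of homotheties in `GL(V)`. -/
def homotheties : Subgroup (V ≃ₗ[k] V) :=
  (DistribMulAction.toModuleAut k V : kˣ →* (V ≃ₗ[k] V)).range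

instance homotheties_normal : (homotheties k V).Normal where
  conj_mem := by
    rintro _ ⟨r, rfl⟩ φ
    refine ⟨r, ?_⟩
    ext x
    have h1 : φ (φ⁻¹ x) = x := φ.apply_symm_apply x
    change (r : k) • x = φ ((r : k) • φ⁻¹ x)
    rw [map_smul, h1]

/-- `PGL(V) = GL(V) / k* I`. -/
abbrev PGL : Type v := (V ≃ₗ[k] V) ⧸ homotheties k V

end Projective

/-! ### Hurwitz algebras -/

section Nucleus

variable (A : Type v) [NonAssocRing A]

/-- The nucleus `N(A)`: the elements that associate with all pairs of elements, in every
position. -/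
def nucleus : Subring A where
  carrier := {a | ∀ x y : A, (a * x) * y = a * (x * y) ∧ (x * a) * y = x * (a * y) ∧
    (x * y) * a = x * (y * a)}
  mul_mem' := by
    intro a b ha hb x y
    refine ⟨?_, ?_, ?_⟩
    · rw [(ha b x).1, (ha (b * x) y).1, (hb x y).1, (ha b (x * y)).1]
    · rw [← (ha x b).2.1, (hb (x * a) y).2.1, (ha x (b * y)).2.1, (ha b y).1]
    · rw [← (hb (x * y) a).2.2, (ha x y).2.2, (hb x (y * a)).2.2, (hb y a).2.2]
  one_mem' := by
    intro x y
    simp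
  add_mem' := by
    intro a b ha hb x y
    refine ⟨?_, ?_, ?_⟩
    · simp only [add_mul, (ha x y).1, (hb x y).1]
    · simp only [add_mul, mul_add, (ha x y).2.1, (hb x y).2.1]
    · simp only [mul_add, (ha x y).2.2, (hb x y).2.2]
  zero_mem' := by
    intro x y
    simp
  neg_mem' := by
    intro a ha x y
    refine ⟨?_, ?_, ?_⟩
    · simp only [neg_mul, (ha x y).1]
    · simp only [neg_mul, mul_neg, (ha x y).2.1]
    · simp only [mul_neg, (ha x y).2.2]

/-- The nucleus is associative, so that it has a unit group `N(A)* = (nucleus A)ˣ`. -/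
instance nucleusMonoid : Monoid (nucleus A) where
  mul_assoc a b c := Subtype.ext (a.2 b c).1
  one_mul a := Subtype.ext (one_mul (a : A))
  mul_one a := Subtype.ext (mul_one (a : A))

end Nucleus

section Algebra

variable (k : Type u) (A : Type v) [Field k] [NonAssocRing A] [Module k A]
  [SMulCommClass k A A] [IsScalarTower k A A]

variable {A} in
/-- Left multiplication `L_w` by an invertible element `w` of the nucleus. -/
def leftMul (w : (nucleus A)ˣ) : A ≃ₗ[k] A where
  toFun x := ((w : nucleus A) : A) * x
  map_add' x y := mul_add _ x y
  map_smul' r x := mul_smul_comm r _ x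
  invFun x := ((w⁻¹ : (nucleus A)ˣ) : nucleus A) * x
  left_inv x := by
    have h : (((w⁻¹ : (nucleus A)ˣ) : nucleus A) : A) * ((w : nucleus A) : A) = 1 :=
      congrArg Subtype.val w.inv_mul
    simp only
    rw [← (((w⁻¹ : (nucleus A)ˣ) : nucleus A).2 _ x).1, h, one_mul]
  right_inv x := by
    have h : ((w : nucleus A) : A) * (((w⁻¹ : (nucleus A)ˣ) : nucleus A) : A) = 1 :=
      congrArg Subtype.val w.mul_inv
    simp only
    rw [← ((w : nucleus A).2 _ x).1, h, one_mul]

variable {A} in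
/-- Right multiplication `R_w` by an invertible element `w` of the nucleus. -/
def rightMul (w : (nucleus A)ˣ) : A ≃ₗ[k] A where
  toFun x := x * ((w : nucleus A) : A)
  map_add' x y := add_mul x y _
  map_smul' r x := smul_mul_assoc r x _
  invFun x := x * (((w⁻¹ : (nucleus A)ˣ) : nucleus A) : A)
  left_inv x := by
    have h : ((w : nucleus A) : A) * (((w⁻¹ : (nucleus A)ˣ) : nucleus A) : A) = 1 :=
      congrArg Subtype.val w.mul_inv
    simp only
    rw [((w : nucleus A).2 x _).2.1, h, mul_one]
  right_inv x := by
    have h : (((w⁻¹ : (nucleus A)ˣ) : nucleus A) : A) * ((w : nucleus A) : A) = 1 :=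
      congrArg Subtype.val w.inv_mul
    simp only
    rw [(((w⁻¹ : (nucleus A)ˣ) : nucleus A).2 x _).2.1, h, mul_one]

theorem leftMul_one : leftMul k (1 : (nucleus A)ˣ) = 1 := by
  ext x
  exact one_mul x

theorem rightMul_one : rightMul k (1 : (nucleus A)ˣ) = 1 := by
  ext x
  exact mul_one x

theorem leftMul_mul (w z : (nucleus A)ˣ) :
    leftMul k (w * z) = leftMul k w * leftMul k z := by
  ext x
  exact ((w : nucleus A).2 _ x).1

theorem rightMul_mul (w z : (nucleus A)ˣ) :
    rightMul k (w * z) = rightMul k z * rightMul k w := by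
  ext x
  exact ((w : nucleus A).2 x _).2.1.symm

/-- The action `w · (α, β) = (R_w⁻¹ α, L_w β)` of `N(A)*` on `PGL(A)²`. -/
instance nuclearAction : MulAction (nucleus A)ˣ (PGL k A × PGL k A) where
  smul w p := ((((rightMul k w)⁻¹ : A ≃ₗ[k] A) : PGL k A) * p.1, (leftMul k w : PGL k A) * p.2)
  one_smul p := by
    change ((((rightMul k (1 : (nucleus A)ˣ))⁻¹ : A ≃ₗ[k] A) : PGL k A) * p.1,
      (leftMul k (1 : (nucleus A)ˣ) : PGL k A) * p.2) = p
    rw [leftMul_one, rightMul_one, inv_one, QuotientGroup.mk_one, one_mul, one_mul]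
  mul_smul w z p := by
    change ((((rightMul k (w * z))⁻¹ : A ≃ₗ[k] A) : PGL k A) * p.1,
        (leftMul k (w * z) : PGL k A) * p.2) =
      ((((rightMul k w)⁻¹ : A ≃ₗ[k] A) : PGL k A) *
          ((((rightMul k z)⁻¹ : A ≃ₗ[k] A) : PGL k A) * p.1),
        (leftMul k w : PGL k A) * ((leftMul k z : PGL k A) * p.2))
    rw [leftMul_mul, rightMul_mul, mul_inv_rev, QuotientGroup.mk_mul, QuotientGroup.mk_mul,
      mul_assoc, mul_assoc]

/-- The orbit set `X_A = PGL(A)² / N(A)*`. -/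
def XSet : Type v := MulAction.orbitRel.Quotient (nucleus A)ˣ (PGL k A × PGL k A)

variable {k A} in
/-- The element of `X_A` represented by `(α, β) ∈ GL(A)²`. -/
def XSet.mk (α β : A ≃ₗ[k] A) : XSet k A :=
  Quotient.mk (MulAction.orbitRel (nucleus A)ˣ (PGL k A × PGL k A)) ((α : PGL k A), (β : PGL k A))

/-! ### Principal isotopes -/

/-- A principal isotope of `A`: an algebra structure on the vector space `A` whose
multiplication is `x ∘ y = α(x) β(y)` for some `α, β ∈ GL(A)`. Two isotopes are equal if and only
if their multiplications are. -/
@[ext]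
structure PrincipalIsotope where
  /-- the multiplication of the isotope -/
  mul : A →ₗ[k] A →ₗ[k] A
  exists_isotopy : ∃ α β : A ≃ₗ[k] A, ∀ x y : A, mul x y = α x * β y

variable {k A} in
/-- The principal isotope `A_{α,β}`. -/
def isotope (α β : A ≃ₗ[k] A) : PrincipalIsotope k A where
  mul := (LinearMap.mul k A).compl₁₂ (α : A →ₗ[k] A) (β : A →ₗ[k] A)
  exists_isotopy := ⟨α, β, fun _ _ => rfl⟩

variable {k A} in
/-- Isomorphisms of principal isotopes: linear bijections compatible with the
multiplications. -/
@[ext]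
structure PrincipalIsotope.Iso (B C : PrincipalIsotope k A) where
  /-- the underlying linear bijection -/
  toLinearEquiv : A ≃ₗ[k] A
  map_mul : ∀ x y : A, toLinearEquiv (B.mul x y) = C.mul (toLinearEquiv x) (toLinearEquiv y)

/-- The groupoid of principal isotopes of `A` and their isomorphisms. -/
instance isotopeGroupoid : Groupoid (PrincipalIsotope k A) where
  Hom B C := PrincipalIsotope.Iso B C
  id B := ⟨LinearEquiv.refl k A, fun _ _ => rfl⟩
  comp f g := ⟨f.toLinearEquiv.trans g.toLinearEquiv, fun x y => by
    simp only [LinearEquiv.trans_apply, f.map_mul, g.map_mul]⟩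
  inv f := ⟨f.toLinearEquiv.symm, fun x y => by
    apply f.toLinearEquiv.injective
    simp only [f.map_mul, LinearEquiv.apply_symm_apply]⟩
  inv_comp f := PrincipalIsotope.Iso.ext (LinearEquiv.symm_trans_self f.toLinearEquiv)
  comp_inv f := PrincipalIsotope.Iso.ext (LinearEquiv.self_trans_symm f.toLinearEquiv)

/-! ### The group `PG(A)` and the triality action -/

variable {k A}

/-- The non-zero unital algebra `A` is a Hurwitz algebra with norm `n`. -/
structure IsHurwitz (n : QuadraticForm k A) : Prop where
  nontrivial : Nontrivial A
  nonDegenerate : NonDegenerate n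
  map_mul : ∀ a b : A, n (a * b) = n a * n b

/-- The similitudes `φ₁`, `φ₂` are triality components of `φ`. -/
structure IsTriality (n : QuadraticForm k A) (φ φ₁ φ₂ : A ≃ₗ[k] A) : Prop where
  mem_left : φ₁ ∈ GO n
  mem_right : φ₂ ∈ GO n
  map_mul : ∀ x y : A, φ (x * y) = φ₁ x * φ₂ y

variable [FiniteDimensional k A]

/-- The group `G(A)`: all similitudes if `dim A ≤ 2`, and the proper ones otherwise. -/
def G (n : QuadraticForm k A) (h : IsHurwitz n) : Subgroup (A ≃ₗ[k] A) :=
  if Module.finrank k A ≤ 2 then GO n else GOplus n h.nonDegenerate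

/-- `PG(A) = G(A) / k* I`. -/
abbrev PG (n : QuadraticForm k A) (h : IsHurwitz n) : Type v :=
  G n h ⧸ (homotheties k A).subgroupOf (G n h)

/-- The given action of `PG(A)` on `X_A` is the triality action: every `φ ∈ G(A)` has triality
components, and `φ · (α, β) = (φ₁ α φ⁻¹, φ₂ β φ⁻¹)` for every choice `φ₁`, `φ₂` of them. -/
structure IsTrialityAction (n : QuadraticForm k A) (h : IsHurwitz n)
    (act : MulAction (PG n h) (XSet k A)) : Prop where
  exists_components : ∀ φ : G n h, ∃ φ₁ φ₂ : A ≃ₗ[k] A, IsTriality n φ φ₁ φ₂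
  smul_mk : ∀ (φ : G n h) (φ₁ φ₂ : A ≃ₗ[k] A), IsTriality n φ φ₁ φ₂ → ∀ α β : A ≃ₗ[k] A,
    act.smul (φ : PG n h) (XSet.mk α β) =
      XSet.mk (φ₁ * α * (φ : A ≃ₗ[k] A)⁻¹) (φ₂ * β * (φ : A ≃ₗ[k] A)⁻¹)

end Algebra

end HurwitzIsotope

end

namespace HurwitzIsotope

open QuadraticMap

/-! ### Identities in composition algebras -/

section Identities

variable {k : Type*} {A : Type*} [Field k] [NonAssocRing A] [Module k A]
  [SMulCommClass k A A] [IsScalarTower k A A] {n : QuadraticForm k A}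

/-! The theorem reduces to two facts. (1) A point of `X_A` is the same thing as a multiplication
`α(x)β(y)` up to a scalar (`XSet.mk_eq_mk_iff`). Two pairs giving the same multiplication differ by
some `w` with `(xw)y = x(wy)`, and since associators alternate this already puts `w` in the nucleus.
(2) `G(A)` is exactly the group of autotopies of `A`, the linear automorphisms that have triality
components (`G_eq_autotopyGroup`). Given these, the action is transport of structure along `φ`, and
an isomorphism of isotopes is visibly an autotopy. The functor is full because an isomorphism up to
a scalar `c` becomes a genuine one after multiplication by `c`. It is faithful because two
proportional isomorphisms with the same source and target are equal.

For (2), a similitude `φ` is `L_a` with `a = φ(1)`, followed on the right by an isometry fixing `1`,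
which is a product of reflections (`mem_reflectionGroup`); the fixed vector of norm `1` avoids the
exceptional case of the Cartan–Dieudonné theorem. The left Moufang identity makes `L_a` an autotopy,
and the middle one makes every reflection times the standard involution an autotopy. Hence even
products of reflections are autotopies, and odd ones are if and only if the involution is. It is one
in dimension at most two, where `A` is commutative, and is not in higher dimension, where only
scalars commute with everything. There parity is detected by the determinant or the Dickson
invariant, once `L_a` is known to be proper (`IsHurwitz.det_leftEquiv`,
`IsHurwitz.dickson_leftEquiv`). -/

theorem NonDegenerate.ext {V : Type*} [AddCommGroup V] [Module k V] {q : QuadraticForm k V}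
    (hq : NonDegenerate q) {x y : V} (hxy : ∀ z, polar q x z = polar q y z) : x = y :=
  sub_eq_zero.mp (hq _ fun z => by rw [polar_sub_left, hxy, sub_self])

/-- The standard involution `x ↦ ⟨x, 1⟩ 1 - x`. -/
def bar (n : QuadraticForm k A) (x : A) : A := polar n x 1 • (1 : A) - x

theorem bar_add (x y : A) : bar n (x + y) = bar n x + bar n y := by
  simp only [bar, polar_add_left]
  module

theorem bar_smul (c : k) (x : A) : bar n (c • x) = c • bar n x := by
  simp only [bar, polar_smul_left, smul_eq_mul]
  module

namespace IsHurwitz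

theorem map_one (h : IsHurwitz n) : n 1 = 1 := by
  have := h.nontrivial
  by_contra hne
  have h1 : n 1 * (n 1 - 1) = 0 := by
    have := h.map_mul 1 1
    rw [one_mul] at this
    linear_combination -this
  have h0 : n 1 = 0 := (mul_eq_zero.mp h1).resolve_right (sub_ne_zero.mpr hne)
  have hz : ∀ x, n x = 0 := fun x => by
    have := h.map_mul 1 x
    rwa [one_mul, h0, zero_mul] at this
  exact one_ne_zero (h.nonDegenerate (1 : A) fun y => by simp [polar, hz])

theorem map_smul_one (h : IsHurwitz n) (c : k) : n (c • (1 : A)) = c * c := by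
  rw [QuadraticMap.map_smul, h.map_one, smul_eq_mul, mul_one]

theorem polar_one_one (h : IsHurwitz n) : polar n (1 : A) 1 = 2 := by
  rw [polar_self, h.map_one]
  simp

theorem polar_mul_left (h : IsHurwitz n) (x y z : A) :
    polar n (x * y) (x * z) = n x * polar n y z := by
  simp only [polar, ← mul_add, h.map_mul]
  ring

theorem polar_mul_right (h : IsHurwitz n) (x y z : A) :
    polar n (x * z) (y * z) = polar n x y * n z := by
  simp only [polar, ← add_mul, h.map_mul]
  ring

/-- Full linearization of `n(ab) = n(a)n(b)`. All later identities come from it by testing against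
the non-degenerate polar form. -/
theorem polar_mul_mul (h : IsHurwitz n) (x y z w : A) :
    polar n (x * y) (z * w) + polar n (x * w) (z * y) = polar n x z * polar n y w := by
  have h1 := h.polar_mul_left (x + z) y w
  have h2 := h.polar_mul_left x y w
  have h3 := h.polar_mul_left z y w
  have h4 : n (x + z) = n x + n z + polar n x z := by simp [polar]
  simp only [add_mul, polar_add_left, polar_add_right, h2, h3, h4] at h1
  rw [polar_comm n (z * y)] at h1
  linear_combination h1

/-- The case of `polar_mul_mul` with third argument `1`: the adjoint of `L_x` is left multiplication
by the conjugate of `x`. -/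
theorem polar_mul_eq_bar_mul (h : IsHurwitz n) (x y z : A) :
    polar n (x * y) z = polar n y (bar n x * z) := by
  have h1 := h.polar_mul_mul x y 1 z
  simp only [one_mul] at h1
  rw [bar, sub_mul, smul_mul_assoc, one_mul, polar_sub_right, polar_smul_right, smul_eq_mul,
    polar_comm n y (x * z)]
  linear_combination h1

theorem polar_mul_eq_mul_bar (h : IsHurwitz n) (x y z : A) :
    polar n (x * y) z = polar n x (z * bar n y) := by
  have h1 := h.polar_mul_mul x y z 1
  simp only [mul_one] at h1
  rw [bar, mul_sub, mul_smul_comm, mul_one, polar_sub_right, polar_smul_right, smul_eq_mul]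
  linear_combination h1

theorem polar_bar_left (x y : A) : polar n (bar n x) y = polar n x (bar n y) := by
  simp only [bar, polar_sub_left, polar_sub_right, polar_smul_left, polar_smul_right, smul_eq_mul,
    polar_comm n 1 y]
  ring

theorem polar_bar_one (h : IsHurwitz n) (x : A) : polar n (bar n x) 1 = polar n x 1 := by
  simp only [bar, polar_sub_left, polar_smul_left, smul_eq_mul, h.polar_one_one]
  ring

theorem bar_bar (h : IsHurwitz n) (x : A) : bar n (bar n x) = x := by
  rw [bar, h.polar_bar_one, bar]
  abel

theorem bar_one (h : IsHurwitz n) : bar n (1 : A) = 1 := by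
  rw [bar, h.polar_one_one, two_smul]
  abel

theorem bar_mul_mul (h : IsHurwitz n) (x y : A) : bar n x * (x * y) = n x • y :=
  h.nonDegenerate.ext fun z => by
    rw [h.polar_mul_eq_bar_mul, h.bar_bar, h.polar_mul_left, polar_smul_left, smul_eq_mul]

theorem mul_mul_bar (h : IsHurwitz n) (x y : A) : (y * x) * bar n x = n x • y :=
  h.nonDegenerate.ext fun z => by
    rw [h.polar_mul_eq_mul_bar, h.bar_bar, h.polar_mul_right, polar_smul_left, smul_eq_mul,
      mul_comm]

theorem bar_mul_self (h : IsHurwitz n) (x : A) : bar n x * x = n x • (1 : A) := by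
  simpa using h.bar_mul_mul x 1

theorem mul_bar_self (h : IsHurwitz n) (x : A) : x * bar n x = n x • (1 : A) := by
  simpa using h.mul_mul_bar x 1

theorem map_bar (h : IsHurwitz n) (x : A) : n (bar n x) = n x := by
  have h1 := h.mul_bar_self (bar n x)
  rw [h.bar_bar, h.bar_mul_self] at h1
  have := h.nontrivial
  exact (smul_left_injective k (one_ne_zero (α := A)) h1).symm

theorem mul_bar_mul (h : IsHurwitz n) (x y : A) : x * (bar n x * y) = n x • y := by
  simpa only [h.bar_bar, h.map_bar] using h.bar_mul_mul (bar n x) y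

theorem mul_bar_mul' (h : IsHurwitz n) (x y : A) : (y * bar n x) * x = n x • y := by
  simpa only [h.bar_bar, h.map_bar] using h.mul_mul_bar (bar n x) y

theorem mul_self (h : IsHurwitz n) (x : A) : x * x = polar n x 1 • x - n x • (1 : A) := by
  have h1 := h.bar_mul_self x
  rw [bar, sub_mul, smul_mul_assoc, one_mul] at h1
  rw [← h1]
  abel

/-- Alternativity is `bar_mul_mul` with the conjugate written out as `⟨x,1⟩1 - x`, combined with the
quadratic equation `mul_self`. -/
theorem mul_mul_left (h : IsHurwitz n) (x y : A) : x * (x * y) = (x * x) * y := by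
  have h1 := h.bar_mul_mul x y
  rw [bar, sub_mul, smul_mul_assoc, one_mul] at h1
  rw [h.mul_self, sub_mul, smul_mul_assoc, smul_mul_assoc, one_mul, ← h1]
  abel

theorem mul_mul_right (h : IsHurwitz n) (x y : A) : (y * x) * x = y * (x * x) := by
  have h1 := h.mul_mul_bar x y
  rw [bar, mul_sub, mul_smul_comm, mul_one] at h1
  rw [h.mul_self, mul_sub, mul_smul_comm, mul_smul_comm, mul_one, ← h1]
  abel

theorem mul_add_mul (h : IsHurwitz n) (x y : A) :
    x * y + y * x = polar n x 1 • y + polar n y 1 • x - polar n x y • (1 : A) := by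
  have h1 := h.mul_self (x + y)
  have h4 : n (x + y) = n x + n y + polar n x y := by simp [polar]
  simp only [mul_add, add_mul, h.mul_self x, h.mul_self y, h4, polar_add_left] at h1
  linear_combination (norm := module) h1

theorem bar_mul (h : IsHurwitz n) (x y : A) : bar n (x * y) = bar n y * bar n x := by
  refine h.nonDegenerate.ext fun z => ?_
  rw [polar_bar_left, h.polar_mul_eq_bar_mul, h.polar_mul_eq_bar_mul, h.bar_bar,
    polar_comm n (bar n x), h.polar_mul_eq_mul_bar]

/-! ### Moufang identities -/

/-- Linearization of `x̄ (x y) = n(x) y`. -/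
theorem bar_mul_mul_add (h : IsHurwitz n) (x z y : A) :
    bar n x * (z * y) + bar n z * (x * y) = polar n x z • y := by
  have h1 := h.bar_mul_mul (x + z) y
  have h4 : n (x + z) = n x + n z + polar n x z := by simp [polar]
  simp only [bar_add, mul_add, add_mul, h.bar_mul_mul, h4] at h1
  linear_combination (norm := module) h1

/-- For `n a ≠ 0` the right side is `-n(a)` times the reflection in `a` applied to the conjugate of
`x`; this links reflections to the multiplication. -/
theorem mul_mul_self (h : IsHurwitz n) (a x : A) :
    (a * x) * a = polar n a (bar n x) • a - n a • bar n x := by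
  refine h.nonDegenerate.ext fun z => ?_
  have h1 := h.polar_mul_mul a x z (bar n a)
  rw [h.mul_bar_self, polar_smul_left, polar_comm n 1, h.polar_mul_eq_mul_bar z, one_mul] at h1
  rw [h.polar_mul_eq_mul_bar, polar_sub_left, polar_smul_left, polar_smul_left,
    polar_comm n a (bar n x), polar_bar_left, polar_comm n (bar n x)]
  simp only [smul_eq_mul] at h1 ⊢
  linear_combination h1

theorem left_moufang (h : IsHurwitz n) (a x y : A) : a * (x * (a * y)) = ((a * x) * a) * y := by
  have h1 := h.bar_mul_mul_add (bar n x) a y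
  rw [h.bar_bar] at h1
  rw [h.mul_mul_self, eq_sub_of_add_eq h1, mul_sub, h.mul_bar_mul, sub_mul, mul_smul_comm,
    smul_mul_assoc, smul_mul_assoc, polar_comm n a]

theorem middle_moufang (h : IsHurwitz n) (a x y : A) : (a * x) * (y * a) = (a * (x * y)) * a := by
  refine h.nonDegenerate.ext fun z => ?_
  -- These four arguments make one term collapse through `(x̄ ā) a = n(a) x̄`, which is the `n(a)`
  -- term of `mul_mul_self`.
  have h1 := h.polar_mul_mul y a (bar n x * bar n a) z
  rw [h.mul_bar_mul', polar_smul_right, h.polar_mul_eq_mul_bar y z, ← h.polar_mul_eq_bar_mul,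
    ← polar_bar_left, ← h.polar_mul_eq_bar_mul, ← polar_bar_left] at h1
  rw [h.polar_mul_eq_bar_mul (a * x), h.bar_mul, h.mul_mul_self, polar_sub_left, polar_smul_left,
    polar_smul_left, polar_comm n a (bar n (x * y))]
  simp only [smul_eq_mul] at h1 ⊢
  linear_combination h1

/-! ### Associators and the nucleus -/

theorem associator_swap_left (h : IsHurwitz n) (x y z : A) :
    (x * y) * z - x * (y * z) = -((y * x) * z - y * (x * z)) := by
  have h1 := h.mul_mul_left (x + y) z
  simp only [add_mul, mul_add, h.mul_mul_left x z, h.mul_mul_left y z] at h1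
  linear_combination (norm := module) -h1

theorem associator_swap_right (h : IsHurwitz n) (x y z : A) :
    (x * y) * z - x * (y * z) = -((x * z) * y - x * (z * y)) := by
  have h1 := h.mul_mul_right (y + z) x
  simp only [add_mul, mul_add, h.mul_mul_right y x, h.mul_mul_right z x] at h1
  linear_combination (norm := module) h1

theorem associator_cyclic (h : IsHurwitz n) (x y z : A) :
    (x * y) * z - x * (y * z) = (y * z) * x - y * (z * x) := by
  rw [h.associator_swap_left, h.associator_swap_right y x z, neg_neg]

/-- The associator is alternating, so its vanishing with `w` in one position gives the other two. -/
theorem mem_nucleus_of_middle (h : IsHurwitz n) {w : A} (hw : ∀ x y, (x * w) * y = x * (w * y)) :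
    w ∈ nucleus A := by
  intro x y
  refine ⟨?_, hw x y, ?_⟩
  · rw [← sub_eq_zero, h.associator_swap_left, hw, sub_self, neg_zero]
  · rw [← sub_eq_zero, h.associator_swap_right, hw, sub_self, neg_zero]

theorem bar_mem_nucleus (h : IsHurwitz n) {w : A} (hw : w ∈ nucleus A) : bar n w ∈ nucleus A := by
  refine h.mem_nucleus_of_middle fun x y => ?_
  rw [bar, mul_sub, sub_mul, sub_mul, mul_sub, (hw x y).2.1]
  simp only [mul_smul_comm, smul_mul_assoc, mul_one, one_mul]

/-! ### Invertible elements -/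

theorem inv_mul_cancel_left (h : IsHurwitz n) {a : A} (ha : n a ≠ 0) (x : A) :
    ((n a)⁻¹ • bar n a) * (a * x) = x := by
  rw [smul_mul_assoc, h.bar_mul_mul, smul_smul, inv_mul_cancel₀ ha, one_smul]

theorem mul_inv_cancel_left (h : IsHurwitz n) {a : A} (ha : n a ≠ 0) (x : A) :
    a * (((n a)⁻¹ • bar n a) * x) = x := by
  rw [smul_mul_assoc, mul_smul_comm, h.mul_bar_mul, smul_smul, inv_mul_cancel₀ ha, one_smul]

theorem mul_inv_cancel_right (h : IsHurwitz n) {a : A} (ha : n a ≠ 0) (x : A) :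
    (x * a) * ((n a)⁻¹ • bar n a) = x := by
  rw [mul_smul_comm, h.mul_mul_bar, smul_smul, inv_mul_cancel₀ ha, one_smul]

theorem inv_mul_cancel_right (h : IsHurwitz n) {a : A} (ha : n a ≠ 0) (x : A) :
    (x * ((n a)⁻¹ • bar n a)) * a = x := by
  rw [mul_smul_comm, smul_mul_assoc, h.mul_bar_mul', smul_smul, inv_mul_cancel₀ ha, one_smul]

theorem ne_zero_left (h : IsHurwitz n) {a b : A} (hab : a * b = 1) : n a ≠ 0 := fun h0 => by
  have h1 := h.map_mul a b
  rw [hab, h.map_one, h0, zero_mul] at h1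
  exact one_ne_zero h1

theorem ne_zero_right (h : IsHurwitz n) {a b : A} (hab : a * b = 1) : n b ≠ 0 := fun h0 => by
  have h1 := h.map_mul a b
  rw [hab, h.map_one, h0, mul_zero] at h1
  exact one_ne_zero h1

theorem eq_inv_of_mul_eq_one (h : IsHurwitz n) {a b : A} (hab : a * b = 1) :
    a = (n b)⁻¹ • bar n b := by
  have h1 := h.mul_inv_cancel_right (h.ne_zero_right hab) a
  rwa [hab, one_mul, eq_comm] at h1

end IsHurwitz

/-! ### Multiplication operators and uniqueness of the norm -/

/-- Left multiplication by an element of non-zero norm. -/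
def leftEquiv (h : IsHurwitz n) (a : A) (ha : n a ≠ 0) : A ≃ₗ[k] A :=
  LinearEquiv.ofLinearMap (LinearMap.mulLeft k a) (LinearMap.mulLeft k ((n a)⁻¹ • bar n a))
    (LinearMap.ext (h.mul_inv_cancel_left ha)) (LinearMap.ext (h.inv_mul_cancel_left ha))

/-- Right multiplication by an element of non-zero norm. -/
def rightEquiv (h : IsHurwitz n) (a : A) (ha : n a ≠ 0) : A ≃ₗ[k] A :=
  LinearEquiv.ofLinearMap (LinearMap.mulRight k a) (LinearMap.mulRight k ((n a)⁻¹ • bar n a))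
    (LinearMap.ext (h.inv_mul_cancel_right ha)) (LinearMap.ext (h.mul_inv_cancel_right ha))

theorem leftEquiv_apply (h : IsHurwitz n) (a : A) (ha : n a ≠ 0) (x : A) :
    leftEquiv h a ha x = a * x := rfl

theorem leftEquiv_symm_apply (h : IsHurwitz n) (a : A) (ha : n a ≠ 0) (x : A) :
    (leftEquiv h a ha).symm x = ((n a)⁻¹ • bar n a) * x := rfl

theorem rightEquiv_apply (h : IsHurwitz n) (a : A) (ha : n a ≠ 0) (x : A) :
    rightEquiv h a ha x = x * a := rfl

/-- The standard involution as a linear automorphism. -/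
def barEquiv (h : IsHurwitz n) : A ≃ₗ[k] A where
  toFun := bar n
  map_add' := bar_add
  map_smul' := bar_smul
  invFun := bar n
  left_inv := h.bar_bar
  right_inv := h.bar_bar

theorem barEquiv_apply (h : IsHurwitz n) (x : A) : barEquiv h x = bar n x := rfl

theorem barEquiv_mul_self (h : IsHurwitz n) : barEquiv h * barEquiv h = 1 :=
  LinearEquiv.ext h.bar_bar

/-- The norm of a Hurwitz algebra is determined by the multiplication. -/
theorem IsHurwitz.norm_unique {n' : QuadraticForm k A} (h : IsHurwitz n) (h' : IsHurwitz n')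
    (x : A) : n x = n' x := by
  have := h.nontrivial
  have h1 := h.mul_self x
  rw [h'.mul_self x] at h1
  by_cases ht : polar n x 1 = polar n' x 1
  · rw [ht, sub_right_inj] at h1
    exact (smul_left_injective k (one_ne_zero (α := A)) h1).symm
  -- Two quadratic equations for `x` with different traces make `x` a scalar, and on scalars both
  -- norms are the square.
  · have hx : x = ((polar n x 1 - polar n' x 1)⁻¹ * (n x - n' x)) • (1 : A) := by
      have h2 : (polar n x 1 - polar n' x 1) • x = (n x - n' x) • (1 : A) := by
        linear_combination (norm := module) -h1
      rw [mul_smul, ← h2, smul_smul, inv_mul_cancel₀ (sub_ne_zero.mpr ht), one_smul]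
    rw [hx, h.map_smul_one, h'.map_smul_one]

end Identities

end HurwitzIsotope

namespace HurwitzIsotope

open QuadraticMap

/-! ### Generation of isometries by reflections -/

section Reflections

variable {k : Type*} {V : Type*} [Field k] [AddCommGroup V] [Module k V] {q : QuadraticForm k V}

theorem HasMultiplier.polar {φ : V ≃ₗ[k] V} {m : kˣ} (h : HasMultiplier q φ m) (x y : V) :
    polar q (φ x) (φ y) = (m : k) * polar q x y := by
  simp only [QuadraticMap.polar, ← map_add, h x, h y, h (x + y)]
  ring

theorem inv_smul_polarBilin_self {a : V} (ha : q a ≠ 0) :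
    ((q a)⁻¹ • q.polarBilin a) a = (2 : k) := by
  rw [LinearMap.smul_apply, polarBilin_apply_apply, polar_self, smul_eq_mul, nsmul_eq_mul]
  field_simp
  norm_cast

/-- The reflection `x ↦ x - q(a)⁻¹ ⟨x, a⟩ a` in a non-singular vector `a`. -/
def reflection (q : QuadraticForm k V) (a : V) (ha : q a ≠ 0) : V ≃ₗ[k] V :=
  Module.reflection (inv_smul_polarBilin_self ha)

theorem reflection_apply {a : V} (ha : q a ≠ 0) (x : V) :
    reflection q a ha x = x - ((q a)⁻¹ * polar q x a) • a := by
  rw [reflection, Module.reflection_apply, polar_comm]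
  rfl

theorem reflection_isometry {a : V} (ha : q a ≠ 0) : HasMultiplier q (reflection q a ha) 1 := by
  intro x
  have h1 : ∀ c : k, q (x - c • a) = q x - c * polar q x a + c * c * q a := by
    intro c
    have h2 : QuadraticMap.polar q x (-(c • a)) = q (x - c • a) - q x - c * c * q a := by
      rw [QuadraticMap.polar, ← sub_eq_add_neg, QuadraticMap.map_neg, QuadraticMap.map_smul,
        smul_eq_mul]
    rw [polar_neg_right, polar_smul_right, smul_eq_mul] at h2
    linear_combination -h2
  rw [reflection_apply, h1, Units.val_one]
  field_simp
  ring

/-- The subgroup generated by the reflections. -/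
def reflectionGroup (q : QuadraticForm k V) : Subgroup (V ≃ₗ[k] V) :=
  Subgroup.closure {s | ∃ (a : V) (ha : q a ≠ 0), s = reflection q a ha}

theorem reflection_mem {a : V} (ha : q a ≠ 0) : reflection q a ha ∈ reflectionGroup q :=
  Subgroup.subset_closure ⟨a, ha, rfl⟩

theorem isometry_of_mem_reflectionGroup {φ : V ≃ₗ[k] V} (hφ : φ ∈ reflectionGroup q) :
    HasMultiplier q φ 1 := by
  induction hφ using Subgroup.closure_induction with
  | mem x hx =>
    obtain ⟨a, ha, rfl⟩ := hx
    exact reflection_isometry ha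
  | one => exact HasMultiplier.one q
  | mul x y _ _ hx hy => simpa using hx.mul hy
  | inv x _ hx => simpa using hx.inv

/-- A product of two reflections acting on `x^⊥` as a transvection with axis `x`, where `x` is
singular. -/
theorem exists_mem_reflectionGroup_add_smul {p x : V} (hp : q p ≠ 0) (hx : q x = 0)
    (hpx : polar q p x = 0) (c : k) : ∃ g ∈ reflectionGroup q,
      ∀ z, polar q z x = 0 → g z = z + (c * ((q p)⁻¹ * polar q z p)) • x := by
  have hn : q (p + c • x) = q p := by
    have h2 : polar q p (c • x) = 0 := by rw [polar_smul_right, hpx, smul_zero]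
    rw [QuadraticMap.polar, QuadraticMap.map_smul, hx, smul_zero, sub_zero] at h2
    exact sub_eq_zero.mp h2
  -- The two reflections used are those in `p` and `p + c x`, vectors of equal norm whose difference
  -- is a multiple of `x`.
  have hn' : q (p + c • x) ≠ 0 := hn ▸ hp
  refine ⟨reflection q _ hn' * reflection q p hp,
    mul_mem (reflection_mem hn') (reflection_mem hp), fun z hz => ?_⟩
  have hs : (q p)⁻¹ * polar q p p = 2 := by
    rw [polar_self, nsmul_eq_mul]
    field_simp
    norm_cast
  rw [LinearEquiv.mul_apply, reflection_apply hp, reflection_apply hn', hn, polar_sub_left,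
    polar_smul_left, polar_add_right, polar_add_right, polar_smul_right, polar_smul_right, hz, hpx]
  simp only [smul_eq_mul, mul_zero, add_zero]
  have e : (q p)⁻¹ * (polar q z p - (q p)⁻¹ * polar q z p * polar q p p) =
      -((q p)⁻¹ * polar q z p) := by
    linear_combination (-(q p)⁻¹ * polar q z p) * hs
  rw [e]
  module

/-- The space of vectors fixed by `φ`. -/
def fixedSpace (φ : V ≃ₗ[k] V) : Submodule k V := LinearMap.eqLocus (φ : V →ₗ[k] V) LinearMap.id

theorem mem_fixedSpace {φ : V ≃ₗ[k] V} {x : V} : x ∈ fixedSpace φ ↔ φ x = x := Iff.rfl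

/-- A non-trivial isometry fixing a non-singular vector can be multiplied by reflections so as to
enlarge its space of fixed vectors. -/
theorem exists_mem_reflectionGroup_fixedSpace_lt (hq : NonDegenerate q) {φ : V ≃ₗ[k] V}
    (hφ : HasMultiplier q φ 1) {w : V} (hw : q w ≠ 0) (hφw : φ w = w) (hne : φ ≠ 1) :
    ∃ g ∈ reflectionGroup q, fixedSpace φ < fixedSpace (g * φ) := by
  have hpol : ∀ x y, polar q (φ x) (φ y) = polar q x y := fun x y => by
    rw [hφ.polar, Units.val_one, one_mul]
  have hqφ : ∀ x, q (φ x) = q x := fun x => by rw [hφ, Units.val_one, one_mul]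
  -- Fixed vectors are orthogonal to every displacement `φ u - u`, so reflections in displacements
  -- do not disturb them.
  have hperp : ∀ f ∈ fixedSpace φ, ∀ u, polar q f (φ u - u) = 0 := fun f hf u => by
    have h1 := hpol f u
    rw [mem_fixedSpace.mp hf] at h1
    rw [polar_sub_right, h1, sub_self]
  have hvx : ∀ v, polar q v (φ v - v) = -q (φ v - v) := fun v => by
    have h1 : polar q v (φ v - v) = q (φ v) - q v - q (φ v - v) := by
      rw [QuadraticMap.polar, add_sub_cancel]
    rw [h1, hqφ]
    ring
  -- It suffices to send one moved vector back to its place while fixing everything that `φ` fixes.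
  have key : ∀ (v : V) (g : V ≃ₗ[k] V), φ v ≠ v → g ∈ reflectionGroup q →
      (∀ f ∈ fixedSpace φ, g f = f) → g (φ v) = v →
      ∃ g ∈ reflectionGroup q, fixedSpace φ < fixedSpace (g * φ) := by
    intro v g hv hg hgf hgv
    refine ⟨g, hg, lt_of_le_of_ne (fun f hf => ?_) fun heq => hv ?_⟩
    · rw [mem_fixedSpace, LinearEquiv.mul_apply, mem_fixedSpace.mp hf, hgf f hf]
    · rw [← mem_fixedSpace, heq]
      exact hgv
  -- If some displacement is non-singular, the reflection in it will do. Otherwise the displacements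
  -- are all singular and mutually orthogonal, and four reflections built from the fixed vector `w`
  -- are needed.
  by_cases hsing : ∀ v, q (φ v - v) = 0
  · obtain ⟨v, hv⟩ : ∃ v, φ v ≠ v := by
      by_contra hall
      push Not at hall
      exact hne (LinearEquiv.ext hall)
    -- If `v` were orthogonal to all displacements, then `⟨φ v, φ u⟩ = ⟨v, u⟩ = ⟨v, φ u⟩` for all
    -- `u`, hence `φ v = v`.
    obtain ⟨u, hu⟩ : ∃ u, polar q v (φ u - u) ≠ 0 := by
      by_contra hall
      push Not at hall
      refine hv (sub_eq_zero.mp (hq _ fun y => ?_))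
      have h1 := hall (φ.symm y)
      rw [φ.apply_symm_apply, polar_sub_right] at h1
      have h2 := hpol v (φ.symm y)
      rw [φ.apply_symm_apply] at h2
      have h3 : polar q (φ v - v) y = polar q (φ v) y - polar q v y := polar_sub_left q _ _ _
      rw [h3, h2]
      linear_combination -h1
    have hxx : ∀ a b, polar q (φ a - a) (φ b - b) = 0 := fun a b => by
      have e : φ a - a + (φ b - b) = φ (a + b) - (a + b) := by
        rw [map_add]
        abel
      rw [QuadraticMap.polar, e, hsing, hsing, hsing]
      simp
    have hwx : ∀ a, polar q w (φ a - a) = 0 := hperp w hφw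
    set x := φ v - v with hx
    set y := φ u - u with hy
    have hqp : q (y - w) = q w := by
      have h1 : polar q y (-w) = 0 := by rw [polar_neg_right, polar_comm, hwx, neg_zero]
      rw [QuadraticMap.polar, ← sub_eq_add_neg, hsing, QuadraticMap.map_neg, sub_zero] at h1
      exact sub_eq_zero.mp h1
    have hqp0 : q (y - w) ≠ 0 := hqp ▸ hw
    have hpx : polar q (y - w) x = 0 := by rw [polar_sub_left, hxx, hwx, sub_zero]
    -- Transvections with axis `x` for `p = w` and for `p = y - w`, two vectors of the same norm:
    -- their effects add up to a multiple of `⟨z,w⟩ + ⟨z,y-w⟩ = ⟨z,y⟩`. The constant is chosen so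
    -- that the product takes `φ v = v + x` to `v`.
    obtain ⟨g₁, hg₁, e₁⟩ := exists_mem_reflectionGroup_add_smul hw (hsing v) (hwx v)
      (-(q w * (polar q v y)⁻¹))
    obtain ⟨g₂, hg₂, e₂⟩ := exists_mem_reflectionGroup_add_smul hqp0 (hsing v) hpx
      (-(q w * (polar q v y)⁻¹))
    have hg : ∀ z, polar q z x = 0 → (g₂ * g₁) z = z - ((polar q v y)⁻¹ * polar q z y) • x := by
      intro z hz
      have hxx' : polar q x x = 0 := hxx v v
      have hxp : polar q x (y - w) = 0 := by rw [polar_comm, hpx]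
      have hzy : polar q z (y - w) = polar q z y - polar q z w := polar_sub_right q _ _ _
      rw [LinearEquiv.mul_apply, e₁ z hz, e₂ _ (by
        rw [polar_add_left, polar_smul_left, hz, hxx', smul_zero, add_zero]), hqp, polar_add_left,
        polar_smul_left, hxp, smul_zero, add_zero, hzy, add_assoc, ← add_smul,
        sub_eq_add_neg z, ← neg_smul]
      congr 2
      field_simp
      ring
    refine key v (g₂ * g₁) hv (mul_mem hg₂ hg₁) (fun f hf => ?_) ?_
    · rw [hg f (hperp f hf v), hperp f hf u, mul_zero, zero_smul, sub_zero]
    · have hφv : φ v = v + x := by rw [hx, add_sub_cancel]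
      have h0 : polar q v x = 0 := by rw [hvx, hsing, neg_zero]
      have h1 : polar q (φ v) x = 0 := by rw [hφv, polar_add_left, h0, hxx, add_zero]
      rw [hg _ h1, hφv, polar_add_left, hxx, add_zero, inv_mul_cancel₀ hu, one_smul,
        add_sub_cancel_right]
  · push Not at hsing
    obtain ⟨v, hv⟩ := hsing
    refine key v (reflection q _ hv) (fun h0 => hv (by rw [h0, sub_self, QuadraticMap.map_zero]))
      (reflection_mem hv) (fun f hf => ?_) ?_
    · rw [reflection_apply, hperp f hf, mul_zero, zero_smul, sub_zero]
    · have h1 : polar q (φ v) (φ v - v) = q (φ v - v) := by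
        have e : φ v = v + (φ v - v) := by rw [add_sub_cancel]
        have h2 := hvx v
        have h3 := polar_self q (φ v - v)
        rw [nsmul_eq_mul, polar_sub_left, Nat.cast_ofNat] at h3
        linear_combination h2 + h3
      rw [reflection_apply, h1, inv_mul_cancel₀ hv, one_smul, sub_sub_cancel]

/-- An isometry of a non-degenerate quadratic space that fixes a non-singular vector is a product
of reflections. -/
theorem mem_reflectionGroup [FiniteDimensional k V] (hq : NonDegenerate q) {φ : V ≃ₗ[k] V}
    (hφ : HasMultiplier q φ 1) {w : V} (hw : q w ≠ 0) (hφw : φ w = w) :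
    φ ∈ reflectionGroup q := by
  -- Induction on the codimension of the fixed space; `w` stays fixed because that space only grows.
  induction hN : Module.finrank k V - Module.finrank k (fixedSpace φ) using Nat.strong_induction_on
    generalizing φ with
  | _ N ih =>
    by_cases hne : φ = 1
    · exact hne ▸ one_mem _
    obtain ⟨g, hg, hlt⟩ := exists_mem_reflectionGroup_fixedSpace_lt hq hφ hw hφw hne
    have h1 := Submodule.finrank_lt_finrank_of_lt hlt
    have h2 := Submodule.finrank_le (fixedSpace (g * φ))
    have h3 : g * φ ∈ reflectionGroup q :=
      ih _ (by omega) (by simpa using (isometry_of_mem_reflectionGroup hg).mul hφ)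
        (hlt.le (mem_fixedSpace.mpr hφw)) rfl
    exact (mul_mem_cancel_left hg).mp h3

end Reflections

end HurwitzIsotope

namespace HurwitzIsotope

open QuadraticMap

/-! ### Maps with triality components -/

section Triality

variable {k : Type*} {A : Type*} [Field k] [NonAssocRing A] [Module k A]
  [SMulCommClass k A A] [IsScalarTower k A A] {n : QuadraticForm k A}

variable (k A) in
/-- The group of autotopies: linear automorphisms `φ` with `φ (x y) = φ₁(x) φ₂(y)` for suitable
linear automorphisms `φ₁`, `φ₂`. -/
def autotopyGroup : Subgroup (A ≃ₗ[k] A) where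
  carrier := {φ | ∃ φ₁ φ₂ : A ≃ₗ[k] A, ∀ x y, φ (x * y) = φ₁ x * φ₂ y}
  mul_mem' := by
    rintro φ ψ ⟨φ₁, φ₂, hφ⟩ ⟨ψ₁, ψ₂, hψ⟩
    exact ⟨φ₁ * ψ₁, φ₂ * ψ₂, fun x y => by simp only [LinearEquiv.mul_apply, hψ, hφ]⟩
  one_mem' := ⟨1, 1, fun x y => rfl⟩
  inv_mem' := by
    rintro φ ⟨φ₁, φ₂, hφ⟩
    refine ⟨φ₁.symm, φ₂.symm, fun x y => ?_⟩
    change φ.symm (x * y) = _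
    rw [LinearEquiv.symm_apply_eq, hφ, φ₁.apply_symm_apply, φ₂.apply_symm_apply]

theorem leftEquiv_hasMultiplier (h : IsHurwitz n) {a : A} (ha : n a ≠ 0) :
    HasMultiplier n (leftEquiv h a ha) (Units.mk0 _ ha) := fun x => h.map_mul a x

/-- Autotopies of a Hurwitz algebra consist of similitudes. -/
theorem IsHurwitz.mem_GO_of_autotopy (h : IsHurwitz n) {φ φ₁ φ₂ : A ≃ₗ[k] A}
    (hφ : ∀ x y, φ (x * y) = φ₁ x * φ₂ y) : φ ∈ GO n ∧ IsTriality n φ φ₁ φ₂ := by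
  have hl : ∀ y, φ y = φ₁ 1 * φ₂ y := fun y => by rw [← hφ, one_mul]
  have hr : ∀ x, φ x = φ₁ x * φ₂ 1 := fun x => by rw [← hφ, mul_one]
  have ha : n (φ₁ 1) ≠ 0 :=
    h.ne_zero_left (b := φ₂ (φ.symm 1)) (by rw [← hl, φ.apply_symm_apply])
  have hb : n (φ₂ 1) ≠ 0 :=
    h.ne_zero_right (a := φ₁ (φ.symm 1)) (by rw [← hr, φ.apply_symm_apply])
  have hc : n (φ₁ 1) * n (φ₂ 1) ≠ 0 := mul_ne_zero ha hb
  -- The norm pulled back along `φ` and rescaled is again a multiplicative non-degenerate norm, so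
  -- it equals `n` by uniqueness. Hence `φ` is a similitude, and so are its components, which differ
  -- from `φ` by multiplications.
  let n' : QuadraticForm k A := (n (φ₁ 1) * n (φ₂ 1))⁻¹ • n.comp (φ : A →ₗ[k] A)
  have hn' : ∀ x, n' x = (n (φ₁ 1) * n (φ₂ 1))⁻¹ * n (φ x) := fun x => rfl
  have h' : IsHurwitz n' := by
    refine ⟨h.nontrivial, fun x hx => ?_, fun x y => ?_⟩
    · refine φ.map_eq_zero_iff.mp (h.nonDegenerate _ fun y => ?_)
      have h1 := hx (φ.symm y)
      simp only [polar, hn', map_add, φ.apply_symm_apply, ← mul_sub] at h1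
      exact (mul_eq_zero.mp h1).resolve_left (inv_ne_zero hc)
    · have h1 : n (φ x) = n (φ₁ x) * n (φ₂ 1) := by rw [hr, h.map_mul]
      have h2 : n (φ y) = n (φ₁ 1) * n (φ₂ y) := by rw [hl, h.map_mul]
      rw [hn', hn', hn', h1, h2, hφ, h.map_mul]
      field_simp
  have hm : ∀ x, n (φ x) = (n (φ₁ 1) * n (φ₂ 1)) * n x := fun x => by
    rw [h.norm_unique h' x, hn', mul_inv_cancel_left₀ hc]
  refine ⟨⟨Units.mk0 _ hc, hm⟩, ⟨Units.mk0 _ ha, fun x => ?_⟩, ⟨Units.mk0 _ hb, fun x => ?_⟩, hφ⟩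
  · have h1 := hm x
    rw [hr x, h.map_mul] at h1
    exact mul_right_cancel₀ hb (h1.trans (by rw [Units.val_mk0]; ring))
  · have h1 := hm x
    rw [hl x, h.map_mul] at h1
    exact mul_left_cancel₀ ha (h1.trans (by rw [Units.val_mk0]; ring))

/-- The left Moufang identity with `y` replaced by `a⁻¹y` reads `a(xy) = ((ax)a)(a⁻¹y)`. -/
theorem leftEquiv_mem_autotopyGroup (h : IsHurwitz n) {a : A} (ha : n a ≠ 0) :
    leftEquiv h a ha ∈ autotopyGroup k A :=
  ⟨rightEquiv h a ha * leftEquiv h a ha, (leftEquiv h a ha).symm, fun x y => by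
    rw [leftEquiv_symm_apply, LinearEquiv.mul_apply, rightEquiv_apply, leftEquiv_apply,
      leftEquiv_apply, ← h.left_moufang, h.mul_inv_cancel_left ha]⟩

theorem smul_mem_autotopyGroup (c : kˣ) {φ : A ≃ₗ[k] A} (hφ : φ ∈ autotopyGroup k A) :
    DistribMulAction.toModuleAut k A c * φ ∈ autotopyGroup k A := by
  obtain ⟨φ₁, φ₂, hφ⟩ := hφ
  refine ⟨DistribMulAction.toModuleAut k A c * φ₁, φ₂, fun x y => ?_⟩
  change (c : k) • φ (x * y) = ((c : k) • φ₁ x) * φ₂ y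
  rw [hφ, smul_mul_assoc]

/-- By `mul_mul_self` this map is `x ↦ -n(a)⁻¹ (ax)a`, and middle Moufang gives `x ↦ (ax)a` the
components `L_a`, `R_a`. -/
theorem reflection_mul_barEquiv_mem (h : IsHurwitz n) {a : A} (ha : n a ≠ 0) :
    reflection n a ha * barEquiv h ∈ autotopyGroup k A := by
  have h1 : rightEquiv h a ha * leftEquiv h a ha ∈ autotopyGroup k A :=
    ⟨leftEquiv h a ha, rightEquiv h a ha, fun x y => (h.middle_moufang a x y).symm⟩
  convert smul_mem_autotopyGroup (-(Units.mk0 _ ha)⁻¹) h1 using 1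
  ext x
  change reflection n a ha (bar n x) = (((-(Units.mk0 _ ha)⁻¹ : kˣ) : k)) • ((a * x) * a)
  rw [reflection_apply, h.mul_mul_self, polar_comm, Units.val_neg, Units.val_inv_eq_inv_val,
    Units.val_mk0, smul_sub, neg_smul, neg_smul, smul_smul, smul_smul, inv_mul_cancel₀ ha]
  module

/-- The involution is an anti-automorphism, so conjugating by it swaps the two components. -/
theorem barEquiv_conj_mem (h : IsHurwitz n) {φ : A ≃ₗ[k] A} (hφ : φ ∈ autotopyGroup k A) :
    barEquiv h * φ * barEquiv h ∈ autotopyGroup k A := by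
  obtain ⟨φ₁, φ₂, hφ⟩ := hφ
  refine ⟨barEquiv h * φ₂ * barEquiv h, barEquiv h * φ₁ * barEquiv h, fun x y => ?_⟩
  simp only [LinearEquiv.mul_apply, barEquiv_apply, h.bar_mul, hφ]

theorem mul_barEquiv_mul_barEquiv (h : IsHurwitz n) (φ : A ≃ₗ[k] A) :
    φ * barEquiv h * barEquiv h = φ := by
  rw [mul_assoc, barEquiv_mul_self, mul_one]

/-! ### The centre -/

/-- The vectors orthogonal to `1` have dimension at least two, so they do not all lie on one line.
-/
theorem exists_polar_one_eq_zero [FiniteDimensional k A] (hd : 2 < Module.finrank k A) (b : A) :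
    ∃ z, polar n z 1 = 0 ∧ ∀ c : k, z ≠ c • b := by
  by_contra hall
  push Not at hall
  let t : A →ₗ[k] k := n.polarBilin 1
  have hle : LinearMap.ker t ≤ Submodule.span k {b} := by
    intro z hz
    obtain ⟨c, rfl⟩ := hall z (by rw [polar_comm]; exact hz)
    exact Submodule.smul_mem _ _ (Submodule.mem_span_singleton_self b)
  have h1 := Submodule.finrank_mono hle
  have h2 := finrank_span_le_card (R := k) ({b} : Set A)
  have h3 := LinearMap.finrank_range_add_finrank_ker t
  have h4 := Submodule.finrank_le (LinearMap.range t)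
  rw [Module.finrank_self] at h4
  simp only [Set.toFinset_singleton, Finset.card_singleton] at h2
  omega

theorem IsHurwitz.exists_polar_one_eq_one (h : IsHurwitz n) : ∃ u, polar n u 1 = 1 := by
  have := h.nontrivial
  obtain ⟨v, hv⟩ : ∃ v, polar n (1 : A) v ≠ 0 := by
    by_contra hall
    push Not at hall
    exact one_ne_zero (h.nonDegenerate _ hall)
  refine ⟨(polar n 1 v)⁻¹ • v, ?_⟩
  rw [polar_smul_left, polar_comm n v, smul_eq_mul, inv_mul_cancel₀ hv]

/-- In dimension greater than two, only scalars commute with everything. -/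
theorem IsHurwitz.eq_smul_one_of_commute [FiniteDimensional k A] (h : IsHurwitz n)
    (hd : 2 < Module.finrank k A) {b : A} (hb : ∀ y, b * y = y * b) :
    ∃ c : k, b = c • (1 : A) := by
  by_cases h2 : (2 : k) = 0
  -- In characteristic two, `by + yb = 2by = 0` turns the linearized quadratic equation into a
  -- linear relation between `1`, `b` and `y`.
  · have key : ∀ y, polar n b 1 • y + polar n y 1 • b = polar n b y • (1 : A) := fun y => by
      have h1 := h.mul_add_mul b y
      rw [← hb, ← two_smul k, h2, zero_smul] at h1
      linear_combination (norm := module) -h1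
    obtain ⟨u, hu⟩ := h.exists_polar_one_eq_one
    have hb1 : polar n b 1 = 0 := by
      by_contra hne
      obtain ⟨z, hz, hzb⟩ := exists_polar_one_eq_zero (n := n) hd (1 : A)
      have h1 := key z
      rw [hz, zero_smul, add_zero] at h1
      refine hzb ((polar n b 1)⁻¹ * polar n b z) ?_
      rw [mul_smul, ← h1, smul_smul, inv_mul_cancel₀ hne, one_smul]
    have h1 := key u
    rw [hb1, hu, zero_smul, zero_add, one_smul] at h1
    exact ⟨_, h1⟩
  · let b₀ : A := b - (2⁻¹ * polar n b 1) • (1 : A)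
    have hb₀1 : polar n b₀ 1 = 0 := by
      simp only [b₀, polar_sub_left, polar_smul_left, h.polar_one_one, smul_eq_mul]
      field_simp
      ring
    -- For trace-zero elements `b₀y + yb₀` is a scalar; as they commute and `2 ≠ 0`, so is `b₀y`,
    -- which makes `b₀` a multiple of `y` when `y` is invertible.
    have key : ∀ y, polar n y 1 = 0 → n y ≠ 0 → ∃ c : k, b₀ = c • y := by
      intro y hy hny
      have h1 := h.mul_add_mul b₀ y
      have hcom : y * b₀ = b₀ * y := by
        simp only [b₀, mul_sub, sub_mul, hb, mul_smul_comm, smul_mul_assoc, mul_one, one_mul]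
      rw [hcom, hb₀1, hy, zero_smul, zero_smul, zero_add, zero_sub, ← two_smul k] at h1
      have h3 : b₀ * y = (-(2⁻¹ * polar n b₀ y)) • (1 : A) := by
        rw [← one_smul k (b₀ * y), ← inv_mul_cancel₀ h2, mul_smul, h1]
        module
      have h4 := h.mul_inv_cancel_right hny b₀
      rw [h3, bar, hy, zero_smul, zero_sub, smul_mul_assoc, one_mul, smul_smul] at h4
      exact ⟨_, by rw [← h4, smul_neg, ← neg_smul]⟩
    by_cases hb0 : b₀ = 0
    · exact ⟨_, sub_eq_zero.mp hb0⟩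
    exfalso
    obtain ⟨z, hz, hzb⟩ := exists_polar_one_eq_zero (n := n) hd b₀
    have hprop : ∀ y, polar n y 1 = 0 → n y ≠ 0 → ∃ c : k, y = c • b₀ := by
      intro y hy hny
      obtain ⟨c, hc⟩ := key y hy hny
      have hc0 : c ≠ 0 := fun h0 => hb0 (by rw [hc, h0, zero_smul])
      exact ⟨c⁻¹, by rw [hc, smul_smul, inv_mul_cancel₀ hc0, one_smul]⟩
    -- All non-singular trace-zero vectors lie on the line of `b₀`, and `z + c b₀` does not. Taking
    -- `c = 0, 1, -1` forces `n b₀ = 0`, so no such vectors exist and `b₀` is in the radical.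
    have hsing : ∀ c : k, n (z + c • b₀) = 0 := by
      intro c
      by_contra hne
      obtain ⟨e, he⟩ := hprop (z + c • b₀)
        (by rw [polar_add_left, polar_smul_left, hz, hb₀1, smul_zero, add_zero]) hne
      exact hzb (e - c) (by rw [sub_smul, ← he, add_sub_cancel_right])
    have hnb : n b₀ = 0 := by
      have e0 := hsing 0
      have e1 := hsing 1
      have e2 := hsing (-1)
      have p1 := polar_smul_right n 1 z b₀
      have p2 := polar_smul_right n (-1) z b₀
      rw [zero_smul, add_zero] at e0
      rw [QuadraticMap.polar, e1, e0] at p1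
      rw [QuadraticMap.polar, e2, e0] at p2
      simp only [QuadraticMap.map_smul, smul_eq_mul] at p1 p2
      have : (2 : k) * n b₀ = 0 := by linear_combination -p1 - p2
      exact (mul_eq_zero.mp this).resolve_left h2
    refine hb0 (h.nonDegenerate _ fun y => ?_)
    have hy₀ : ∀ y, polar n y 1 = 0 → polar n b₀ y = 0 := by
      intro y hy
      have hs : n y = 0 := by
        by_contra hne
        obtain ⟨c, rfl⟩ := hprop y hy hne
        exact hne (by rw [QuadraticMap.map_smul, hnb, smul_zero])
      have hs' : n (b₀ + y) = 0 := by
        by_contra hne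
        obtain ⟨c, hc⟩ := hprop (b₀ + y) (by rw [polar_add_left, hb₀1, hy, add_zero]) hne
        exact hne (by rw [hc, QuadraticMap.map_smul, hnb, smul_zero])
      rw [QuadraticMap.polar, hs', hnb, hs]
      simp
    have h5 := hy₀ (y - (2⁻¹ * polar n y 1) • (1 : A)) (by
      simp only [polar_sub_left, polar_smul_left, h.polar_one_one, smul_eq_mul]
      field_simp
      ring)
    rwa [polar_sub_right, polar_smul_right, hb₀1, smul_zero, sub_zero] at h5

/-- In dimension greater than two, the standard involution is not an autotopy. -/
theorem barEquiv_notMem_autotopyGroup [FiniteDimensional k A] (h : IsHurwitz n)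
    (hd : 2 < Module.finrank k A) : barEquiv h ∉ autotopyGroup k A := by
  rintro ⟨φ₁, φ₂, hφ⟩
  simp only [barEquiv_apply, h.bar_mul] at hφ
  have hone : φ₁ 1 * φ₂ 1 = 1 := by rw [← hφ, h.bar_one, one_mul]
  have hb := h.ne_zero_right hone
  have ha := h.eq_inv_of_mul_eq_one hone
  set b := φ₂ 1 with hbdef
  have h1 : ∀ x, φ₁ x = bar n x * ((n b)⁻¹ • bar n b) := fun x => by
    have e := hφ x 1
    rw [h.bar_one, one_mul] at e
    rw [e, h.mul_inv_cancel_right hb]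
  have h2 : ∀ y, φ₂ y = b * bar n y := fun y => by
    have e := hφ 1 y
    rw [h.bar_one, mul_one, ha] at e
    rw [e, h.mul_inv_cancel_left hb]
  -- The components are determined by `b = φ₂ 1`, leaving `yx = (xb⁻¹)(by)`. Taking `x = b` shows
  -- that `b` commutes with everything; then `b` is a scalar and `A` would be commutative.
  have key : ∀ x y, y * x = (x * ((n b)⁻¹ • bar n b)) * (b * y) := fun x y => by
    have e := hφ (bar n x) (bar n y)
    rwa [h1, h2, h.bar_bar, h.bar_bar] at e
  have hbc : ∀ y, b * y = y * b := fun y => by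
    rw [key b y, mul_smul_comm, h.mul_bar_self, smul_smul, inv_mul_cancel₀ hb, one_smul, one_mul]
  obtain ⟨c, hc⟩ := h.eq_smul_one_of_commute hd hbc
  have hcomm : ∀ x y : A, x * y = y * x := fun x y => by
    have hc0 : c ≠ 0 := fun h0 => hb (by rw [hc, h0, zero_smul, QuadraticMap.map_zero])
    have e := key x y
    simp only [hc, bar_smul, h.bar_one, h.map_smul_one, mul_smul_comm, smul_mul_assoc, mul_one,
      one_mul, smul_smul] at e
    rw [e]
    field_simp
    rw [one_smul]
  obtain ⟨z, -, hz⟩ := exists_polar_one_eq_zero (n := n) hd (1 : A)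
  obtain ⟨c, hc⟩ := h.eq_smul_one_of_commute hd (hcomm z)
  exact hz c hc

/-- A Hurwitz algebra of dimension at most two is commutative. -/
theorem IsHurwitz.mul_comm_of_finrank_le_two [FiniteDimensional k A] (h : IsHurwitz n)
    (hd : Module.finrank k A ≤ 2) (x y : A) : x * y = y * x := by
  have := h.nontrivial
  have hli : ¬ LinearIndependent k ![1, x, y] := fun hli => by
    have h1 := hli.fintype_card_le_finrank
    rw [Fintype.card_fin] at h1
    omega
  obtain ⟨g, hg, i, hi⟩ := Fintype.not_linearIndependent_iff.mp hli
  rw [Fin.sum_univ_three] at hg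
  change g 0 • (1 : A) + g 1 • x + g 2 • y = 0 at hg
  by_contra hne
  -- Commutators of the linear relation with `x` and with `y` isolate the coefficients, as `xy ≠
  -- yx`.
  have hc : g 2 = 0 := by
    have h1 : g 2 • (x * y - y * x) =
        x * (g 0 • (1 : A) + g 1 • x + g 2 • y) - (g 0 • (1 : A) + g 1 • x + g 2 • y) * x := by
      simp only [mul_add, add_mul, mul_smul_comm, smul_mul_assoc, mul_one, one_mul]
      module
    rw [hg, mul_zero, zero_mul, sub_zero] at h1
    exact (smul_eq_zero.mp h1).resolve_right (sub_ne_zero.mpr hne)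
  have hb : g 1 = 0 := by
    have h1 : g 1 • (x * y - y * x) =
        (g 0 • (1 : A) + g 1 • x + g 2 • y) * y - y * (g 0 • (1 : A) + g 1 • x + g 2 • y) := by
      simp only [mul_add, add_mul, mul_smul_comm, smul_mul_assoc, mul_one, one_mul]
      module
    rw [hg, mul_zero, zero_mul, sub_zero] at h1
    exact (smul_eq_zero.mp h1).resolve_right (sub_ne_zero.mpr hne)
  rw [hc, hb, zero_smul, zero_smul, add_zero, add_zero] at hg
  have ha := (smul_eq_zero.mp hg).resolve_right one_ne_zero
  fin_cases i
  · exact hi ha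
  · exact hi hb
  · exact hi hc

theorem barEquiv_mem_autotopyGroup [FiniteDimensional k A] (h : IsHurwitz n)
    (hd : Module.finrank k A ≤ 2) : barEquiv h ∈ autotopyGroup k A :=
  ⟨barEquiv h, barEquiv h, fun x y => by
    rw [barEquiv_apply, h.bar_mul, h.mul_comm_of_finrank_le_two hd]
    rfl⟩

end Triality

end HurwitzIsotope

namespace HurwitzIsotope

open QuadraticMap Polynomial

/-! ### Determinants and Dickson invariants -/

section Quadratic

variable {k : Type*} {V : Type*} [Field k] [AddCommGroup V] [Module k V] [FiniteDimensional k V]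
  {q : QuadraticForm k V}

theorem det_reflection {a : V} (ha : q a ≠ 0) :
    LinearMap.det (reflection q a ha : V →ₗ[k] V) = -1 := by
  have h1 : (reflection q a ha : V →ₗ[k] V) =
      LinearMap.transvection ((q a)⁻¹ • q.polarBilin a) (-a) := by
    ext x
    change Module.reflection (inv_smul_polarBilin_self ha) x = x + ((q a)⁻¹ • q.polarBilin a) x • -a
    rw [Module.reflection_apply, smul_neg, sub_eq_add_neg]
  rw [h1, LinearMap.transvection.det, map_neg, inv_smul_polarBilin_self ha]
  norm_num

/-- The reflection is `1 + N` with `N` of rank one. The two terms of the trace linear in `N` agree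
and cancel in characteristic two; the quadratic term is `tr (lN)² = -tr (lN) = 1`, because `⟨l a, a⟩
= q a`. -/
theorem dickson_reflection (h2 : (2 : k) = 0) {l : Module.End k V} (hl : Represents q l) {a : V}
    (ha : q a ≠ 0) : dickson l (reflection q a ha) = 1 := by
  set f : Module.Dual k V := (q a)⁻¹ • q.polarBilin a with hf
  set N : Module.End k V := f.smulRight (-a) with hN
  have e1 : (reflection q a ha : V →ₗ[k] V) = 1 + N := by
    ext x
    change Module.reflection (inv_smul_polarBilin_self ha) x = x + f x • -a
    rw [Module.reflection_apply, smul_neg, sub_eq_add_neg]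
  have e2 : (reflection q a ha)⁻¹ = reflection q a ha := Module.reflection_inv _
  have e3 : f (l (-a)) = -1 := by
    rw [map_neg, map_neg, hf, LinearMap.smul_apply, polarBilin_apply_apply, polar_comm, hl,
      smul_eq_mul, inv_mul_cancel₀ ha]
  have e4 : l * N = f.smulRight (l (-a)) := by
    ext x
    simp [hN]
  have e5 : l * N * (l * N) = -(l * N) := by
    ext x
    rw [e4]
    simp only [Module.End.mul_apply, LinearMap.smulRight_apply, map_smul, e3,
      LinearMap.neg_apply]
    module
  have e6 : l * ((1 + N) * l * (1 + N) - l) = l * N * l + l * (l * N) + l * N * (l * N) := by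
    noncomm_ring
  rw [dickson, e2, e1, e6, map_add, map_add, LinearMap.trace_mul_comm, ← two_mul, h2, zero_mul,
    zero_add, e5, map_neg, e4, LinearMap.trace_smulRight, e3, neg_neg]

/-- In characteristic two, the Dickson invariant does not depend on the representing
endomorphism. -/
theorem dickson_eq (hq : NonDegenerate q) (h2 : (2 : k) = 0) {l l' : Module.End k V}
    (hl : Represents q l) (hl' : Represents q l') {φ : V ≃ₗ[k] V} {m : kˣ}
    (hφ : HasMultiplier q φ m) : dickson l φ = dickson l' φ := by
  have e1 : ∀ l : Module.End k V, dickson l φ = LinearMap.trace k V (l * (conj φ l - l)) :=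
    fun l => rfl
  -- The difference of the two invariants is split into traces of products of two alternating
  -- endomorphisms, which vanish.
  have e2 : l * (conj φ l - l) = (l - l') * (conj φ l - l) +
      (l' * conj φ (l - l') - l' * (l - l') + l' * (conj φ l' - l')) := by
    rw [conj_sub]
    noncomm_ring
  have e3 : conj φ⁻¹ l' * (l - l') - l' * (l - l') = (conj φ⁻¹ l' - l') * (l - l') := by
    rw [sub_mul]
  have e4 := trace_alternating_mul hq h2 _ _ ((represents_conj hφ.inv hl').sub_alternating hl')
    (hl.sub_alternating hl')
  rw [← e3, map_sub] at e4
  rw [e1, e1, e2, map_add, map_add, map_sub, trace_conj_mul, e4, zero_add,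
    trace_alternating_mul hq h2 _ _ (hl.sub_alternating hl')
      ((represents_conj hφ hl).sub_alternating hl), zero_add]

/-- Adjoint endomorphisms have the same characteristic polynomial. -/
theorem charpoly_eq_of_adjoint (hq : NonDegenerate q) {s t : Module.End k V}
    (hst : ∀ x y, polar q (s x) y = polar q x (t y)) : s.charpoly = t.charpoly := by
  classical
  let e := Module.finBasis k V
  let b : LinearMap.BilinForm k V := q.polarBilin
  have hnd : b.Nondegenerate := by
    refine ⟨fun x hx => hq x hx, fun y hy => hq y fun x => ?_⟩
    rw [polar_comm]
    exact hy x
  set B := LinearMap.BilinForm.toMatrix e b with hB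
  have hBdet : IsUnit B.det :=
    isUnit_iff_ne_zero.mpr ((LinearMap.BilinForm.nondegenerate_iff_det_ne_zero e).mp hnd)
  have h1 : (LinearMap.toMatrix e e s).transpose * B = B * LinearMap.toMatrix e e t := by
    rw [hB, ← LinearMap.BilinForm.toMatrix_compRight, ← LinearMap.BilinForm.toMatrix_compLeft]
    congr 1
    ext x y
    exact hst x y
  rw [← LinearMap.charpoly_toMatrix s e, ← LinearMap.charpoly_toMatrix t e,
    ← Matrix.charpoly_transpose (LinearMap.toMatrix e e s),
    ← Matrix.nonsing_inv_mul_cancel_left B (LinearMap.toMatrix e e t) hBdet, ← h1,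
    Matrix.charpoly_mul_comm, Matrix.mul_nonsing_inv_cancel_right _ _ hBdet]

end Quadratic

/-! ### Left multiplications are proper similitudes -/

section Algebra

variable {k : Type*} {A : Type*} [Field k] [NonAssocRing A] [Module k A]
  [SMulCommClass k A A] [IsScalarTower k A A] [FiniteDimensional k A] {n : QuadraticForm k A}

theorem IsHurwitz.charpoly_mulLeft_bar (h : IsHurwitz n) (a : A) :
    (LinearMap.mulLeft k (bar n a)).charpoly = (LinearMap.mulLeft k a).charpoly :=
  (charpoly_eq_of_adjoint h.nonDegenerate fun x y => h.polar_mul_eq_bar_mul a x y).symm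

/-- `L_a` and its adjoint `⟨a,1⟩ - L_a` have the same characteristic polynomial, and the product of
their characteristic matrices is a scalar matrix by the quadratic equation of `a`. -/
theorem IsHurwitz.charpoly_mulLeft_sq (h : IsHurwitz n) (a : A) :
    (LinearMap.mulLeft k a).charpoly * (LinearMap.mulLeft k a).charpoly =
      (X ^ 2 - C (polar n a 1) * X + C (n a)) ^ Module.finrank k A := by
  nth_rw 2 [← h.charpoly_mulLeft_bar]
  let e := Module.finBasis k A
  rw [← LinearMap.charpoly_toMatrix _ e, ← LinearMap.charpoly_toMatrix _ e]
  set M := LinearMap.toMatrix e e (LinearMap.mulLeft k a) with hM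
  have hMbar : LinearMap.toMatrix e e (LinearMap.mulLeft k (bar n a)) = polar n a 1 • 1 - M := by
    have : LinearMap.mulLeft k (bar n a) = polar n a 1 • LinearMap.id - LinearMap.mulLeft k a := by
      ext x
      simp only [bar, LinearMap.mulLeft_apply, LinearMap.sub_apply, LinearMap.smul_apply,
        LinearMap.id_apply, sub_mul, smul_mul_assoc, one_mul]
    rw [this, map_sub, map_smul, LinearMap.toMatrix_id]
  have hMM : M * M = polar n a 1 • M - n a • 1 := by
    rw [hM, ← LinearMap.toMatrix_mul, ← LinearMap.toMatrix_id (v₁ := e), ← map_smul, ← map_smul,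
      ← map_sub]
    congr 1
    ext x
    simp only [LinearMap.mulLeft_apply, LinearMap.sub_apply, LinearMap.smul_apply,
      LinearMap.id_apply, Module.End.mul_apply, h.mul_mul_left, h.mul_self, sub_mul,
      smul_mul_assoc, one_mul]
  rw [hMbar, Matrix.charpoly, Matrix.charpoly, ← Matrix.det_mul]
  set N := (C : k →+* k[X]).mapMatrix M with hN
  have hNN : N * N = C (polar n a 1) • N - C (n a) • 1 := by
    rw [hN, ← RingHom.map_mul, hMM]
    ext1 i j
    by_cases hij : i = j <;> simp [hij]
  have h1 : M.charmatrix = (X : k[X]) • 1 - N := by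
    rw [Matrix.charmatrix, hN, Matrix.scalar_apply, Matrix.smul_one_eq_diagonal]
  have h2 : (polar n a 1 • 1 - M).charmatrix = (X : k[X]) • 1 - (C (polar n a 1) • 1 - N) := by
    rw [Matrix.charmatrix, hN, Matrix.scalar_apply, Matrix.smul_one_eq_diagonal]
    ext1 i j
    by_cases hij : i = j <;> simp [hij]
  have h3 : M.charmatrix * (polar n a 1 • 1 - M).charmatrix =
      (X ^ 2 - C (polar n a 1) * X + C (n a)) • (1 : Matrix _ _ k[X]) := by
    rw [h1, h2]
    simp only [mul_sub, sub_mul, smul_mul_assoc, mul_smul_comm, mul_one, one_mul, hNN]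
    module
  rw [h3, Matrix.det_smul, Matrix.det_one, mul_one, Fintype.card_fin]

theorem IsHurwitz.even_finrank (h : IsHurwitz n) (h2 : (2 : k) ≠ 0)
    (hd : 2 < Module.finrank k A) : Even (Module.finrank k A) := by
  obtain ⟨v, hv1, hv⟩ : ∃ v, polar n v 1 = 0 ∧ n v ≠ 0 := by
    by_contra hall
    push Not at hall
    obtain ⟨z, hz, hz0⟩ := exists_polar_one_eq_zero (n := n) hd (0 : A)
    refine hz0 0 ?_
    rw [smul_zero]
    refine h.nonDegenerate _ fun y => ?_
    set c := 2⁻¹ * polar n y 1 with hc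
    have hy : polar n (y - c • 1) 1 = 0 := by
      rw [polar_sub_left, polar_smul_left, h.polar_one_one, hc, smul_eq_mul]
      field_simp
      ring
    have h1 : polar n z (y - c • 1) = 0 := by
      rw [QuadraticMap.polar, hall z hz, hall _ hy,
        hall _ (by rw [polar_add_left, hz, hy, add_zero])]
      simp
    rwa [polar_sub_right, polar_smul_right, hz, smul_zero, sub_zero] at h1
  -- The conjugate of a trace-zero `v` is `-v`, so equality of characteristic polynomials gives `det
  -- (-L_v) = det L_v ≠ 0`, whence `(-1) ^ dim = 1`.
  have hbar : LinearMap.mulLeft k (bar n v) = (-1 : k) • LinearMap.mulLeft k v := by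
    ext x
    rw [bar, hv1, zero_smul, zero_sub, LinearMap.smul_apply, LinearMap.mulLeft_apply,
      LinearMap.mulLeft_apply, neg_mul, neg_smul, one_smul]
  have hdet := congrArg (fun p : k[X] => (-1) ^ Module.finrank k A * p.coeff 0)
    (h.charpoly_mulLeft_bar v)
  simp only [← LinearMap.det_eq_sign_charpoly_coeff] at hdet
  rw [hbar, LinearMap.det_smul] at hdet
  have hne : LinearMap.det (LinearMap.mulLeft k v) ≠ 0 :=
    (leftEquiv h v hv).isUnit_det'.ne_zero
  have h1 : (-1 : k) ^ Module.finrank k A = 1 := mul_right_cancel₀ hne (by rw [hdet, one_mul])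
  by_contra hodd
  rw [Nat.not_even_iff_odd] at hodd
  rw [hodd.neg_one_pow] at h1
  exact h2 (by linear_combination -h1)

theorem IsHurwitz.det_leftEquiv (h : IsHurwitz n) (h2 : (2 : k) ≠ 0)
    (hd : 2 < Module.finrank k A) {a : A} (ha : n a ≠ 0) :
    LinearMap.det (leftEquiv h a ha : A →ₗ[k] A) = n a ^ (Module.finrank k A / 2) := by
  obtain ⟨e, he⟩ := h.even_finrank h2 hd
  change LinearMap.det (LinearMap.mulLeft k a) = _
  set Q : k[X] := X ^ 2 - C (polar n a 1) * X + C (n a) with hQ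
  have hmonic : Q.Monic := by
    rw [hQ]
    monicity!
  have h1 := h.charpoly_mulLeft_sq a
  rw [← hQ, he, pow_add] at h1
  -- The squares agree, so the polynomials agree up to sign; both are monic and `2 ≠ 0`.
  have h3 : (LinearMap.mulLeft k a).charpoly = Q ^ e := by
    refine (mul_self_eq_mul_self_iff.mp h1).resolve_right fun h4 => h2 ?_
    have h5 := congrArg leadingCoeff h4
    rw [leadingCoeff_neg, (hmonic.pow e).leadingCoeff,
      (LinearMap.charpoly_monic _).leadingCoeff] at h5
    linear_combination h5
  have h0 : Q.coeff 0 = n a := by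
    rw [coeff_zero_eq_eval_zero, hQ]
    simp
  rw [LinearMap.det_eq_sign_charpoly_coeff, h3, coeff_zero_eq_eval_zero, eval_pow,
    ← coeff_zero_eq_eval_zero, h0, Even.neg_one_pow (h.even_finrank h2 hd), one_mul, he]
  congr 1
  omega

theorem IsHurwitz.represents_mulLeft (h : IsHurwitz n) {u : A} (hu : polar n u 1 = 1) :
    Represents n (LinearMap.mulLeft k u) := fun x => by
  have h1 := h.polar_mul_right u 1 x
  rwa [one_mul, hu, one_mul] at h1

theorem IsHurwitz.mulLeft_alternating (h : IsHurwitz n) {u : A} (hu : polar n u 1 = 0) (x : A) :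
    polar n (LinearMap.mulLeft k u x) x = 0 := by
  have h1 := h.polar_mul_right u 1 x
  rwa [one_mul, hu, zero_mul] at h1

/-- Cyclic invariance of the associator makes `L_{xy} - L_x L_y` the commutator of `R_x` and `L_y`.
-/
theorem IsHurwitz.trace_mulLeft_mul (h : IsHurwitz n) (x y : A) :
    LinearMap.trace k A (LinearMap.mulLeft k x * LinearMap.mulLeft k y) =
      LinearMap.trace k A (LinearMap.mulLeft k (x * y)) := by
  have h1 : LinearMap.mulLeft k (x * y) - LinearMap.mulLeft k x * LinearMap.mulLeft k y =
      LinearMap.mulRight k x * LinearMap.mulLeft k y -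
        LinearMap.mulLeft k y * LinearMap.mulRight k x :=
    LinearMap.ext fun z => h.associator_cyclic x y z
  have h3 := congrArg (LinearMap.trace k A) h1
  rw [map_sub, map_sub, LinearMap.trace_mul_comm k (LinearMap.mulRight k x), sub_self] at h3
  exact (sub_eq_zero.mp h3).symm

theorem IsHurwitz.trace_one_eq_zero (h : IsHurwitz n) (h2 : (2 : k) = 0) :
    LinearMap.trace k A 1 = 0 := by
  have h1 : ∀ x : A, polar n ((1 : Module.End k A) x) x = 0 := fun x => by
    rw [Module.End.one_apply, polar_self, nsmul_eq_mul, Nat.cast_ofNat, h2, zero_mul]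
  simpa using trace_alternating_mul h.nonDegenerate h2 1 1 h1 h1

/-- If `⟨p,1⟩ = 0` then `L_p` is alternating and has trace zero. One further element not orthogonal
to `1` suffices: a product `pr` of two such elements with `⟨p,r⟩ ≠ 0`, where the trace is that of
`L_p L_r`. Dimension greater than two is needed to find a non-scalar `p`. -/
theorem IsHurwitz.trace_mulLeft (h : IsHurwitz n) (h2 : (2 : k) = 0)
    (hd : 2 < Module.finrank k A) (a : A) : LinearMap.trace k A (LinearMap.mulLeft k a) = 0 := by
  have h1 : ∀ x : A, polar n ((1 : Module.End k A) x) x = 0 := fun x => by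
    rw [Module.End.one_apply, polar_self, nsmul_eq_mul, Nat.cast_ofNat, h2, zero_mul]
  have h0 : ∀ p : A, polar n p 1 = 0 → LinearMap.trace k A (LinearMap.mulLeft k p) = 0 :=
    fun p hp => by
      simpa using trace_alternating_mul h.nonDegenerate h2 _ 1 (h.mulLeft_alternating hp) h1
  obtain ⟨u, hu⟩ := h.exists_polar_one_eq_one
  obtain ⟨p, hp, hp1⟩ := exists_polar_one_eq_zero (n := n) hd (1 : A)
  obtain ⟨r, hr, hpr⟩ : ∃ r, polar n r 1 = 0 ∧ polar n p r ≠ 0 := by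
    by_contra hall
    push Not at hall
    refine hp1 (polar n p u) (h.nonDegenerate.ext fun y => ?_)
    have h3 := hall (y - polar n y 1 • u)
      (by rw [polar_sub_left, polar_smul_left, hu, smul_eq_mul, mul_one, sub_self])
    rw [polar_sub_right, polar_smul_right, smul_eq_mul] at h3
    rw [polar_smul_left, smul_eq_mul, polar_comm n 1]
    linear_combination h3
  have h3 : LinearMap.trace k A (LinearMap.mulLeft k (p * r)) = 0 := by
    rw [← h.trace_mulLeft_mul]
    exact trace_alternating_mul h.nonDegenerate h2 _ _ (h.mulLeft_alternating hp)
      (h.mulLeft_alternating hr)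
  have h4 : polar n (p * r) 1 ≠ 0 := by
    rw [h.polar_mul_eq_mul_bar, one_mul, bar, hr, zero_smul, zero_sub, polar_neg_right]
    exact neg_ne_zero.mpr hpr
  set c := polar n a 1 * (polar n (p * r) 1)⁻¹ with hc
  have h5 := h0 (a - c • (p * r)) (by
    rw [polar_sub_left, polar_smul_left, smul_eq_mul, hc, inv_mul_cancel_right₀ h4, sub_self])
  have h6 : LinearMap.mulLeft k (a - c • (p * r)) =
      LinearMap.mulLeft k a - c • LinearMap.mulLeft k (p * r) := by
    ext x
    simp [sub_mul, smul_mul_assoc]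
  rwa [h6, map_sub, map_smul, h3, smul_zero, sub_zero] at h5

theorem IsHurwitz.dickson_leftEquiv (h : IsHurwitz n) (h2 : (2 : k) = 0)
    (hd : 2 < Module.finrank k A) {a : A} (ha : n a ≠ 0) {l : Module.End k A}
    (hl : Represents n l) : dickson l (leftEquiv h a ha) = 0 := by
  obtain ⟨u, hu⟩ := h.exists_polar_one_eq_one
  rw [dickson_eq h.nonDegenerate h2 hl (h.represents_mulLeft hu) (leftEquiv_hasMultiplier h ha),
    dickson]
  set b : A := (n a)⁻¹ • bar n a with hb
  have e1 : ((leftEquiv h a ha : A ≃ₗ[k] A) : A →ₗ[k] A) = LinearMap.mulLeft k a := rfl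
  have e2 : (((leftEquiv h a ha)⁻¹ : A ≃ₗ[k] A) : A →ₗ[k] A) = LinearMap.mulLeft k b := rfl
  have e3 : LinearMap.mulLeft k a * LinearMap.mulLeft k b = 1 :=
    LinearMap.ext (h.mul_inv_cancel_left ha)
  have e4 : LinearMap.mulLeft k u * LinearMap.mulLeft k u =
      LinearMap.mulLeft k u - n u • 1 := by
    ext x
    simp only [Module.End.mul_apply, LinearMap.mulLeft_apply, h.mul_mul_left, h.mul_self, hu,
      one_smul, sub_mul, smul_mul_assoc, one_mul, LinearMap.sub_apply, LinearMap.smul_apply,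
      Module.End.one_apply]
  have e5 : LinearMap.mulLeft k u * LinearMap.mulLeft k a =
      LinearMap.mulLeft k a + polar n a 1 • LinearMap.mulLeft k u - polar n u a • 1 -
        LinearMap.mulLeft k a * LinearMap.mulLeft k u := by
    ext x
    have h1 := h.associator_swap_left u a x
    have h3 := congrArg (· * x) (h.mul_add_mul u a)
    simp only [add_mul, sub_mul, smul_mul_assoc, one_mul, hu, one_smul] at h3
    simp only [Module.End.mul_apply, LinearMap.mulLeft_apply, LinearMap.sub_apply,
      LinearMap.smul_apply, LinearMap.add_apply, Module.End.one_apply]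
    linear_combination (norm := module) h3 - h1
  -- Moving `L_u` past `L_a` leaves only terms whose traces vanish: the identity, single left
  -- multiplications and products of two.
  have e6 : LinearMap.mulLeft k u * (LinearMap.mulLeft k a * LinearMap.mulLeft k u *
      LinearMap.mulLeft k b - LinearMap.mulLeft k u) =
      n u • (LinearMap.mulLeft k a * LinearMap.mulLeft k b) +
        polar n a 1 • (LinearMap.mulLeft k u * LinearMap.mulLeft k b) -
        (polar n a 1 * n u) • LinearMap.mulLeft k b -
        polar n u a • (LinearMap.mulLeft k u * LinearMap.mulLeft k b) -
        LinearMap.mulLeft k u + n u • 1 := by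
    calc _ = (LinearMap.mulLeft k u * LinearMap.mulLeft k a) * LinearMap.mulLeft k u *
          LinearMap.mulLeft k b - LinearMap.mulLeft k u * LinearMap.mulLeft k u := by
          noncomm_ring
      _ = _ := by
          rw [e5]
          simp only [add_mul, sub_mul, smul_mul_assoc, one_mul]
          rw [mul_assoc (LinearMap.mulLeft k a) (LinearMap.mulLeft k u) (LinearMap.mulLeft k u), e4]
          simp only [mul_sub, sub_mul, smul_mul_assoc, mul_smul_comm, mul_one, one_mul]
          module
  rw [e1, e2, e6, e3]
  simp only [map_add, map_sub, map_smul, h.trace_mulLeft_mul, h.trace_mulLeft h2 hd,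
    h.trace_one_eq_zero h2, smul_zero, add_zero, sub_zero]

end Algebra

end HurwitzIsotope

namespace HurwitzIsotope

open QuadraticMap

/-! ### The principle of triality: `G(A)` is the group of autotopies -/

section Principle

variable {k : Type*} {A : Type*} [Field k] [NonAssocRing A] [Module k A]
  [SMulCommClass k A A] [IsScalarTower k A A] [FiniteDimensional k A] {n : QuadraticForm k A}

/-- Products of reflections are even or odd; the even ones are autotopies, and the odd ones are so
after multiplication by the standard involution. -/
theorem parity_of_mem_reflectionGroup (h : IsHurwitz n) {g : A ≃ₗ[k] A}
    (hg : g ∈ reflectionGroup n) :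
    (g ∈ autotopyGroup k A ∧ LinearMap.det (g : A →ₗ[k] A) = 1 ∧
      ((2 : k) = 0 → ∀ l, Represents n l → dickson l g = 0)) ∨
    (g * barEquiv h ∈ autotopyGroup k A ∧ LinearMap.det (g : A →ₗ[k] A) = -1 ∧
      ((2 : k) = 0 → ∀ l, Represents n l → dickson l g = 1)) := by
  induction hg using Subgroup.closure_induction with
  | mem x hx =>
    obtain ⟨a, ha, rfl⟩ := hx
    exact Or.inr ⟨reflection_mul_barEquiv_mem h ha, det_reflection ha,
      fun h2 l hl => dickson_reflection h2 hl ha⟩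
  | one =>
    refine Or.inl ⟨one_mem _, ?_, fun _ l _ => dickson_one l⟩
    exact map_one LinearMap.det
  | mul x y hx hy ihx ihy =>
    have hdet : LinearMap.det ((x * y : A ≃ₗ[k] A) : A →ₗ[k] A) =
        LinearMap.det (x : A →ₗ[k] A) * LinearMap.det (y : A →ₗ[k] A) :=
      map_mul LinearMap.det (x : Module.End k A) (y : Module.End k A)
    have hdick : (2 : k) = 0 → ∀ l, Represents n l →
        dickson l (x * y) = dickson l x + dickson l y := fun h2 l hl =>
      dickson_mul h.nonDegenerate h2 hl (isometry_of_mem_reflectionGroup hx)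
        (isometry_of_mem_reflectionGroup hy)
    -- `x z bar = (x bar)(bar z bar)`: an odd `x` can absorb an autotopy on its right.
    have hconj : ∀ z ∈ autotopyGroup k A, x * barEquiv h ∈ autotopyGroup k A →
        x * z * barEquiv h ∈ autotopyGroup k A := fun z hz hxb => by
      have h1 := mul_mem hxb (barEquiv_conj_mem h hz)
      rwa [← mul_assoc, ← mul_assoc, mul_barEquiv_mul_barEquiv] at h1
    rcases ihx with ⟨tx, dx, ex⟩ | ⟨tx, dx, ex⟩ <;> rcases ihy with ⟨ty, dy, ey⟩ | ⟨ty, dy, ey⟩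
    · exact Or.inl ⟨mul_mem tx ty, by rw [hdet, dx, dy, one_mul], fun h2 l hl => by
        rw [hdick h2 l hl, ex h2 l hl, ey h2 l hl, add_zero]⟩
    · exact Or.inr ⟨by rw [mul_assoc]; exact mul_mem tx ty, by rw [hdet, dx, dy, one_mul],
        fun h2 l hl => by rw [hdick h2 l hl, ex h2 l hl, ey h2 l hl, zero_add]⟩
    · exact Or.inr ⟨hconj y ty tx, by rw [hdet, dx, dy, mul_one],
        fun h2 l hl => by rw [hdick h2 l hl, ex h2 l hl, ey h2 l hl, add_zero]⟩
    · refine Or.inl ⟨?_, by rw [hdet, dx, dy, neg_mul_neg, one_mul], fun h2 l hl => ?_⟩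
      · have h1 := hconj _ ty tx
        rwa [← mul_assoc, mul_barEquiv_mul_barEquiv] at h1
      · rw [hdick h2 l hl, ex h2 l hl, ey h2 l hl, one_add_one_eq_two, h2]
  | inv x hx ihx =>
    have hdet : LinearMap.det ((x⁻¹ : A ≃ₗ[k] A) : A →ₗ[k] A) =
        (LinearMap.det (x : A →ₗ[k] A))⁻¹ := LinearEquiv.det_coe_symm x
    have hdick : (2 : k) = 0 → ∀ l, Represents n l → dickson l x⁻¹ = dickson l x :=
      fun h2 l hl => by
        have h1 := dickson_mul h.nonDegenerate h2 hl (isometry_of_mem_reflectionGroup hx)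
          (isometry_of_mem_reflectionGroup hx).inv
        rw [mul_inv_cancel, dickson_one] at h1
        linear_combination -h1 - dickson l x * h2
    rcases ihx with ⟨tx, dx, ex⟩ | ⟨tx, dx, ex⟩
    · exact Or.inl ⟨inv_mem tx, by rw [hdet, dx, inv_one],
        fun h2 l hl => by rw [hdick h2 l hl, ex h2 l hl]⟩
    · refine Or.inr ⟨?_, by rw [hdet, dx, inv_neg, inv_one],
        fun h2 l hl => by rw [hdick h2 l hl, ex h2 l hl]⟩
      have h1 := barEquiv_conj_mem h (inv_mem tx)
      rwa [mul_inv_rev, ← mul_assoc, mul_inv_cancel, one_mul] at h1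

/-- Every similitude is a left multiplication followed by a product of reflections. -/
theorem IsHurwitz.exists_leftEquiv_mul (h : IsHurwitz n) {φ : A ≃ₗ[k] A} {m : kˣ}
    (hφ : HasMultiplier n φ m) : ∃ (a : A) (ha : n a ≠ 0), n a = m ∧
      ∃ g ∈ reflectionGroup n, φ = leftEquiv h a ha * g := by
  have hm : n (φ 1) = m := by rw [hφ, h.map_one, mul_one]
  have ha : n (φ 1) ≠ 0 := hm ▸ m.ne_zero
  refine ⟨φ 1, ha, hm, (leftEquiv h (φ 1) ha)⁻¹ * φ, ?_, (_root_.mul_inv_cancel_left _ _).symm⟩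
  have hu : Units.mk0 _ ha = m := Units.ext hm
  have h1 := (leftEquiv_hasMultiplier h ha).inv.mul hφ
  rw [hu, inv_mul_cancel] at h1
  refine mem_reflectionGroup h.nonDegenerate h1 (w := 1) (by rw [h.map_one]; exact one_ne_zero) ?_
  change (leftEquiv h (φ 1) ha).symm (φ 1) = 1
  rw [LinearEquiv.symm_apply_eq, leftEquiv_apply, mul_one]

/-- After `L_a` is split off, only the parity of the remaining product of reflections matters. In
dimension above two, properness excludes the odd case in one direction; in the other, an odd
autotopy would make the involution an autotopy. -/
theorem G_eq_autotopyGroup (h : IsHurwitz n) : G n h = autotopyGroup k A := by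
  rw [G]
  split_ifs with hd
  · refine le_antisymm ?_ fun φ ⟨φ₁, φ₂, hφ⟩ => (h.mem_GO_of_autotopy hφ).1
    rintro φ ⟨m, hφ⟩
    obtain ⟨a, ha, -, g, hg, rfl⟩ := h.exists_leftEquiv_mul hφ
    refine mul_mem (leftEquiv_mem_autotopyGroup h ha) ?_
    rcases parity_of_mem_reflectionGroup h hg with ⟨h1, -⟩ | ⟨h1, -⟩
    · exact h1
    · exact (mul_mem_cancel_right (barEquiv_mem_autotopyGroup h hd)).mp h1
  · rw [not_le] at hd
    refine le_antisymm ?_ ?_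
    · rintro φ ⟨m, hφ, hdet, hdick⟩
      obtain ⟨a, ha, ham, g, hg, rfl⟩ := h.exists_leftEquiv_mul hφ
      refine mul_mem (leftEquiv_mem_autotopyGroup h ha) ?_
      rcases parity_of_mem_reflectionGroup h hg with ⟨h1, -⟩ | ⟨-, h1, h3⟩
      · exact h1
      exfalso
      by_cases h2 : (2 : k) = 0
      · obtain ⟨u, hu⟩ := h.exists_polar_one_eq_one
        have hl := h.represents_mulLeft hu
        have h4 := hdick h2 _ hl
        rw [dickson_mul h.nonDegenerate h2 hl (leftEquiv_hasMultiplier h ha)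
          (isometry_of_mem_reflectionGroup hg), h3 h2 _ hl, h.dickson_leftEquiv h2 hd ha hl,
          zero_add] at h4
        exact one_ne_zero h4
      · have h4 : LinearMap.det (leftEquiv h a ha : A →ₗ[k] A) *
            LinearMap.det (g : A →ₗ[k] A) = _ :=
          (map_mul LinearMap.det (leftEquiv h a ha : Module.End k A)
            (g : Module.End k A)).symm.trans (hdet h2)
        rw [h.det_leftEquiv h2 hd ha, h1, ham] at h4
        have h5 : (m : k) ^ (Module.finrank k A / 2) ≠ 0 := pow_ne_zero _ m.ne_zero
        have h6 : (2 : k) * (m : k) ^ (Module.finrank k A / 2) = 0 := by linear_combination -h4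
        exact (mul_ne_zero h2 h5) h6
    · intro φ hφ
      obtain ⟨φ₁, φ₂, hφ'⟩ := id hφ
      obtain ⟨m, hm⟩ := (h.mem_GO_of_autotopy hφ').1
      refine ⟨m, hm, ?_⟩
      obtain ⟨a, ha, ham, g, hg, rfl⟩ := h.exists_leftEquiv_mul hm
      have hgT := (mul_mem_cancel_left (leftEquiv_mem_autotopyGroup h ha)).mp hφ
      rcases parity_of_mem_reflectionGroup h hg with ⟨-, h1, h3⟩ | ⟨h1, -⟩
      · refine ⟨fun h2 => ?_, fun h2 l hl => ?_⟩
        · refine (map_mul LinearMap.det (leftEquiv h a ha : Module.End k A)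
            (g : Module.End k A)).trans ?_
          rw [h.det_leftEquiv h2 hd ha, h1, ham, mul_one]
        · rw [dickson_mul h.nonDegenerate h2 hl (leftEquiv_hasMultiplier h ha)
            (isometry_of_mem_reflectionGroup hg), h3 h2 _ hl, h.dickson_leftEquiv h2 hd ha hl,
            zero_add]
      · exact absurd ((mul_mem_cancel_left hgT).mp h1) (barEquiv_notMem_autotopyGroup h hd)

end Principle

/-! ### The orbit set and the triality action -/

section Action

variable {k : Type*} {A : Type*} [Field k] [NonAssocRing A] [Module k A]
  [SMulCommClass k A A] [IsScalarTower k A A] {n : QuadraticForm k A}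

theorem mk_eq_mk_iff {φ ψ : A ≃ₗ[k] A} :
    (φ : PGL k A) = (ψ : PGL k A) ↔ ∃ c : kˣ, ∀ x, ψ x = (c : k) • φ x := by
  rw [QuotientGroup.eq]
  constructor
  · rintro ⟨c, hc⟩
    refine ⟨c, fun x => ?_⟩
    have h1 : ψ = φ * DistribMulAction.toModuleAut k A c := by rw [hc, mul_inv_cancel_left]
    rw [h1]
    exact map_smul φ (c : k) x
  · rintro ⟨c, hc⟩
    refine ⟨c, ?_⟩
    rw [eq_inv_mul_iff_mul_eq]
    ext x
    rw [hc]
    exact map_smul φ (c : k) x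

/-- Pairs defining the same multiplication differ by an invertible element of the nucleus. -/
theorem IsHurwitz.exists_nucleus_of_mul_eq (h : IsHurwitz n) {α β α' β' : A ≃ₗ[k] A}
    (heq : ∀ x y, α x * β y = α' x * β' y) :
    ∃ w : (nucleus A)ˣ, α = (rightMul k w)⁻¹ * α' ∧ β = leftMul k w * β' := by
  set a := α (α'.symm 1) with ha
  set w := β (β'.symm 1) with hw
  have h1 : ∀ x, α x * w = α' x := fun x => by
    rw [hw, heq, β'.apply_symm_apply, mul_one]
  have h2 : ∀ y, a * β y = β' y := fun y => by
    rw [ha, heq, α'.apply_symm_apply, one_mul]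
  have haw : a * w = 1 := by rw [hw, h2, β'.apply_symm_apply]
  have hn := h.ne_zero_right haw
  have hainv := h.eq_inv_of_mul_eq_one haw
  have h3 : ∀ y, β y = w * β' y := fun y => by
    rw [← h2, hainv, h.mul_inv_cancel_left hn]
  -- The two multiplications agree, and substituting `α' = R_w α` and `β = L_w β'` leaves an
  -- associativity condition on `w`.
  have hmid : ∀ x y, (x * w) * y = x * (w * y) := fun x y => by
    have e := heq (α.symm x) (β'.symm y)
    rw [← h1, h3, α.apply_symm_apply, β'.apply_symm_apply] at e
    exact e.symm
  have hmem := h.mem_nucleus_of_middle hmid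
  have hmem' : a ∈ nucleus A := by
    refine h.mem_nucleus_of_middle fun x y => ?_
    have hb := h.bar_mem_nucleus hmem
    rw [hainv, mul_smul_comm, smul_mul_assoc, smul_mul_assoc, mul_smul_comm, (hb x y).2.1]
  have hwa : w * a = 1 := by
    rw [hainv, mul_smul_comm, h.mul_bar_self, smul_smul, inv_mul_cancel₀ hn, one_smul]
  let W : (nucleus A)ˣ := ⟨⟨w, hmem⟩, ⟨a, hmem'⟩, Subtype.ext hwa, Subtype.ext haw⟩
  refine ⟨W, ?_, LinearEquiv.ext h3⟩
  rw [eq_inv_mul_iff_mul_eq]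
  exact LinearEquiv.ext h1

/-- Two pairs define the same element of `X_A` if and only if the multiplications of the
corresponding isotopes are proportional. -/
theorem XSet.mk_eq_mk_iff (h : IsHurwitz n) {α β α' β' : A ≃ₗ[k] A} :
    XSet.mk α β = XSet.mk α' β' ↔ ∃ c : kˣ, ∀ x y, α x * β y = (c : k) • (α' x * β' y) := by
  have h0 : XSet.mk α β = XSet.mk α' β' ↔ ∃ w : (nucleus A)ˣ,
      (((rightMul k w)⁻¹ * α' : A ≃ₗ[k] A) : PGL k A) = α ∧
        ((leftMul k w * β' : A ≃ₗ[k] A) : PGL k A) = β := by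
    refine Quotient.eq.trans (exists_congr fun w => ?_)
    exact Prod.ext_iff
  have hw : ∀ (w : (nucleus A)ˣ) (x y : A), (rightMul k w)⁻¹ x * leftMul k w y = x * y := by
    intro w x y
    obtain ⟨z, rfl⟩ := (rightMul k w).surjective x
    change (rightMul k w).symm (rightMul k w z) * _ = _
    rw [LinearEquiv.symm_apply_apply]
    exact ((w : nucleus A).2 z y).2.1.symm
  rw [h0]
  constructor
  · rintro ⟨w, h1, h2⟩
    obtain ⟨c, hc⟩ := HurwitzIsotope.mk_eq_mk_iff.mp h1
    obtain ⟨d, hd⟩ := HurwitzIsotope.mk_eq_mk_iff.mp h2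
    refine ⟨c * d, fun x y => ?_⟩
    rw [hc, hd, smul_mul_assoc, mul_smul_comm, smul_smul, Units.val_mul, LinearEquiv.mul_apply,
      LinearEquiv.mul_apply, hw]
  · rintro ⟨c, hc⟩
    -- The scalar is absorbed into `α'`, which changes nothing in `PGL`.
    obtain ⟨w, h1, h2⟩ := h.exists_nucleus_of_mul_eq (α := α) (β := β)
      (α' := DistribMulAction.toModuleAut k A c * α') (β' := β') fun x y =>
        (hc x y).trans (smul_mul_assoc _ _ _).symm
    refine ⟨w, HurwitzIsotope.mk_eq_mk_iff.mpr ⟨c, fun x => ?_⟩, by rw [← h2]⟩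
    rw [h1]
    exact map_smul (rightMul k w)⁻¹ (c : k) (α' x)

theorem XSet.exists_rep (x : XSet k A) : ∃ p : (A ≃ₗ[k] A) × (A ≃ₗ[k] A), XSet.mk p.1 p.2 = x := by
  obtain ⟨⟨a, b⟩, rfl⟩ := Quotient.exists_rep x
  obtain ⟨α, rfl⟩ := QuotientGroup.mk_surjective a
  obtain ⟨β, rfl⟩ := QuotientGroup.mk_surjective b
  exact ⟨(α, β), rfl⟩

/-- The multiplication of a transported isotope. -/
theorem autotopy_conj_mul {φ φ₁ φ₂ : A ≃ₗ[k] A} (hφ : ∀ x y, φ (x * y) = φ₁ x * φ₂ y)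
    (α β : A ≃ₗ[k] A) (x y : A) :
    (φ₁ * α * φ⁻¹) x * (φ₂ * β * φ⁻¹) y = φ (α (φ.symm x) * β (φ.symm y)) := by
  rw [hφ]
  rfl

variable [FiniteDimensional k A]

theorem exists_components (h : IsHurwitz n) (φ : G n h) : ∃ p : (A ≃ₗ[k] A) × (A ≃ₗ[k] A),
    IsTriality n φ p.1 p.2 := by
  obtain ⟨φ₁, φ₂, hφ⟩ := (G_eq_autotopyGroup h).le φ.2
  exact ⟨(φ₁, φ₂), (h.mem_GO_of_autotopy hφ).2⟩

theorem PG.mk_eq_mk_iff (h : IsHurwitz n) {φ ψ : G n h} :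
    (φ : PG n h) = (ψ : PG n h) ↔
      ∃ c : kˣ, ∀ x, (ψ : A ≃ₗ[k] A) x = (c : k) • (φ : A ≃ₗ[k] A) x := by
  rw [← HurwitzIsotope.mk_eq_mk_iff, QuotientGroup.eq, QuotientGroup.eq, Subgroup.mem_subgroupOf]
  rfl

/-- Transport of isotopes is well defined up to scalars. -/
theorem mk_conj_eq (h : IsHurwitz n) {φ φ₁ φ₂ ψ ψ₁ ψ₂ α β α' β' : A ≃ₗ[k] A}
    (hφ : IsTriality n φ φ₁ φ₂) (hψ : IsTriality n ψ ψ₁ ψ₂) {c : kˣ}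
    (hc : ∀ x, ψ x = (c : k) • φ x) (heq : XSet.mk α β = XSet.mk α' β') :
    XSet.mk (φ₁ * α * φ⁻¹) (φ₂ * β * φ⁻¹) = XSet.mk (ψ₁ * α' * ψ⁻¹) (ψ₂ * β' * ψ⁻¹) := by
  obtain ⟨d, hd⟩ := (XSet.mk_eq_mk_iff h).mp heq
  have hinv : ∀ x, φ.symm x = (c : k) • ψ.symm x := fun x => by
    rw [LinearEquiv.symm_apply_eq, map_smul, ← hc, ψ.apply_symm_apply]
  -- The two factors `φ⁻¹ = c ψ⁻¹` contribute `c²`, of which one `c` turns the outer `φ` into `ψ`.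
  refine (XSet.mk_eq_mk_iff h).mpr ⟨d * c, fun x y => ?_⟩
  rw [autotopy_conj_mul hφ.map_mul, autotopy_conj_mul hψ.map_mul, hd, hinv, hinv, hc]
  simp only [map_smul, smul_mul_assoc, mul_smul_comm, smul_smul, Units.val_mul]
  congr 1
  ring

/-- The triality action of `PG(A)` on `X_A` exists. -/
theorem exists_trialityAction (h : IsHurwitz n) :
    ∃ act : MulAction (PG n h) (XSet k A), IsTrialityAction n h act := by
  -- Defined by arbitrary choices of representatives and components; `key` shows that none of them
  -- matters.
  let smul (g : PG n h) (x : XSet k A) : XSet k A :=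
    let φ : A ≃ₗ[k] A := g.out
    let p := (exists_components h g.out).choose
    let r := x.exists_rep.choose
    XSet.mk (p.1 * r.1 * φ⁻¹) (p.2 * r.2 * φ⁻¹)
  have key : ∀ (φ : G n h) (φ₁ φ₂ : A ≃ₗ[k] A), IsTriality n φ φ₁ φ₂ → ∀ α β : A ≃ₗ[k] A,
      smul (φ : PG n h) (XSet.mk α β) =
        XSet.mk (φ₁ * α * (φ : A ≃ₗ[k] A)⁻¹) (φ₂ * β * (φ : A ≃ₗ[k] A)⁻¹) := by
    intro φ φ₁ φ₂ hφ α β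
    obtain ⟨c, hc⟩ := (PG.mk_eq_mk_iff h).mp (QuotientGroup.out_eq' (φ : PG n h))
    exact mk_conj_eq h (exists_components h _).choose_spec hφ hc (XSet.exists_rep _).choose_spec
  refine ⟨{ smul := smul, one_smul := fun x => ?_, mul_smul := fun g g' x => ?_ },
    fun φ => ?_, key⟩
  · obtain ⟨⟨α, β⟩, rfl⟩ := x.exists_rep
    obtain ⟨φ, rfl⟩ := QuotientGroup.mk_surjective g
    obtain ⟨ψ, rfl⟩ := QuotientGroup.mk_surjective g'
    obtain ⟨⟨φ₁, φ₂⟩, hφ⟩ := exists_components h φ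
    obtain ⟨⟨ψ₁, ψ₂⟩, hψ⟩ := exists_components h ψ
    have h1 := key (φ * ψ) (φ₁ * ψ₁) (φ₂ * ψ₂)
      ⟨mul_mem hφ.mem_left hψ.mem_left, mul_mem hφ.mem_right hψ.mem_right, fun x y => by
        change (φ : A ≃ₗ[k] A) ((ψ : A ≃ₗ[k] A) (x * y)) = _
        rw [hψ.map_mul, hφ.map_mul]
        rfl⟩ α β
    have h3 := (congrArg (smul φ) (key ψ ψ₁ ψ₂ hψ α β)).trans (key φ φ₁ φ₂ hφ _ _)
    refine h1.trans (Eq.trans ?_ h3.symm)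
    simp only [Subgroup.coe_mul, mul_inv_rev, mul_assoc]
  · obtain ⟨⟨α, β⟩, rfl⟩ := x.exists_rep
    refine (key 1 1 1 ⟨one_mem _, one_mem _, fun _ _ => rfl⟩ α β).trans ?_
    simp
  · obtain ⟨p, hp⟩ := exists_components h φ
    exact ⟨p.1, p.2, hp⟩

end Action

end HurwitzIsotope

namespace HurwitzIsotope

/-! ### The equivalence of groupoids -/

section Equivalence

variable {k : Type*} {A : Type*} [Field k] [NonAssocRing A] [Module k A]
  [SMulCommClass k A A] [IsScalarTower k A A] [FiniteDimensional k A] {n : QuadraticForm k A}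

/-- In terms of multiplications, `φ` maps the class of `(α, β)` to that of `(γ, δ)` if and only if
it is an isomorphism of isotopes up to a scalar. -/
theorem IsTrialityAction.smul_mk_eq_iff {h : IsHurwitz n} {act : MulAction (PG n h) (XSet k A)}
    (hact : IsTrialityAction n h act) (φ : G n h) (α β γ δ : A ≃ₗ[k] A) :
    act.smul (φ : PG n h) (XSet.mk α β) = XSet.mk γ δ ↔
      ∃ c : kˣ, ∀ x y, (φ : A ≃ₗ[k] A) (α x * β y) =
        (c : k) • (γ ((φ : A ≃ₗ[k] A) x) * δ ((φ : A ≃ₗ[k] A) y)) := by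
  obtain ⟨φ₁, φ₂, hφ⟩ := hact.exists_components φ
  rw [hact.smul_mk φ φ₁ φ₂ hφ, XSet.mk_eq_mk_iff h]
  simp only [autotopy_conj_mul hφ.map_mul]
  refine exists_congr fun c => ⟨fun hc x y => ?_, fun hc x y => ?_⟩
  · simpa only [LinearEquiv.symm_apply_apply] using
      hc ((φ : A ≃ₗ[k] A) x) ((φ : A ≃ₗ[k] A) y)
  · rw [hc, LinearEquiv.apply_symm_apply, LinearEquiv.apply_symm_apply]

theorem PrincipalIsotope.exists_rep (B : PrincipalIsotope k A) :
    ∃ p : (A ≃ₗ[k] A) × (A ≃ₗ[k] A), ∀ x y, B.mul x y = p.1 x * p.2 y := by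
  obtain ⟨α, β, hαβ⟩ := B.exists_isotopy
  exact ⟨(α, β), hαβ⟩

/-- The class in `X_A` of a principal isotope. -/
noncomputable def PrincipalIsotope.toXSet (B : PrincipalIsotope k A) : XSet k A :=
  XSet.mk B.exists_rep.choose.1 B.exists_rep.choose.2

theorem PrincipalIsotope.toXSet_eq (h : IsHurwitz n) (B : PrincipalIsotope k A)
    {α β : A ≃ₗ[k] A} (hB : ∀ x y, B.mul x y = α x * β y) : B.toXSet = XSet.mk α β :=
  (XSet.mk_eq_mk_iff h).mpr ⟨1, fun x y => by
    rw [← B.exists_rep.choose_spec, hB, Units.val_one, one_smul]⟩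

/-- Isomorphisms of principal isotopes lie in `G(A)`. -/
theorem PrincipalIsotope.Iso.mem_G (h : IsHurwitz n) {B C : PrincipalIsotope k A}
    (f : PrincipalIsotope.Iso B C) : f.toLinearEquiv ∈ G n h := by
  obtain ⟨⟨α, β⟩, hB⟩ := B.exists_rep
  obtain ⟨⟨γ, δ⟩, hC⟩ := C.exists_rep
  rw [G_eq_autotopyGroup h]
  -- Solving `f(α(x)β(y)) = γ(f x) δ(f y)` for `f(xy)`.
  refine ⟨γ * f.toLinearEquiv * α.symm, δ * f.toLinearEquiv * β.symm, fun x y => ?_⟩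
  have h1 := f.map_mul (α.symm x) (β.symm y)
  rw [hB, hC] at h1
  simp only [LinearEquiv.apply_symm_apply] at h1
  exact h1

theorem IsTrialityAction.smul_toXSet {h : IsHurwitz n} {act : MulAction (PG n h) (XSet k A)}
    (hact : IsTrialityAction n h act) {B C : PrincipalIsotope k A}
    (f : PrincipalIsotope.Iso B C) :
    act.smul ((⟨f.toLinearEquiv, f.mem_G h⟩ : G n h) : PG n h) B.toXSet = C.toXSet := by
  obtain ⟨⟨α, β⟩, hB⟩ := B.exists_rep
  obtain ⟨⟨γ, δ⟩, hC⟩ := C.exists_rep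
  rw [B.toXSet_eq h hB, C.toXSet_eq h hC, hact.smul_mk_eq_iff]
  refine ⟨1, fun x y => ?_⟩
  rw [Units.val_one, one_smul, ← hB, ← hC]
  exact f.map_mul x y

/-- The functor sending `A_{α,β}` to the class of `(α, β)` and an isomorphism to its class in
`PG(A)`. -/
noncomputable def isotopeFunctor (h : IsHurwitz n) [act : MulAction (PG n h) (XSet k A)]
    (hact : IsTrialityAction n h act) :
    PrincipalIsotope k A ⥤ ActionCategory (PG n h) (XSet k A) where
  obj B := ⟨(), B.toXSet⟩
  map f := ⟨((⟨f.toLinearEquiv, f.mem_G h⟩ : G n h) : PG n h), hact.smul_toXSet f⟩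
  map_id _ := rfl
  map_comp _ _ := rfl

instance isotopeFunctor_faithful (h : IsHurwitz n) [act : MulAction (PG n h) (XSet k A)]
    (hact : IsTrialityAction n h act) : (isotopeFunctor h hact).Faithful where
  map_injective {B C} f g hfg := by
    have := h.nontrivial
    obtain ⟨c, hc⟩ := (PG.mk_eq_mk_iff h).mp (congrArg Subtype.val hfg)
    replace hc : ∀ x, g.toLinearEquiv x = (c : k) • f.toLinearEquiv x := hc
    obtain ⟨⟨γ, δ⟩, hC⟩ := C.exists_rep
    -- The images of `x` and `y` under `f` have product `1` in `C`, so comparing `f` with the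
    -- homomorphism `g = c f` there gives `c = c²`.
    let x := f.toLinearEquiv.symm (γ.symm 1)
    let y := f.toLinearEquiv.symm (δ.symm 1)
    have hf : f.toLinearEquiv (B.mul x y) = 1 := by
      rw [f.map_mul, hC]
      simp [x, y]
    have hg := g.map_mul x y
    rw [hc, hc, hc, hf, map_smul, LinearMap.map_smul₂, ← f.map_mul, hf, smul_smul] at hg
    have h1 := smul_left_injective k (one_ne_zero (α := A)) hg
    have h2 : (c : k) = 1 := mul_left_cancel₀ c.ne_zero (h1.symm.trans (mul_one _).symm)
    refine PrincipalIsotope.Iso.ext (LinearEquiv.ext fun z => ?_)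
    rw [hc, h2, one_smul]

instance isotopeFunctor_full (h : IsHurwitz n) [act : MulAction (PG n h) (XSet k A)]
    (hact : IsTrialityAction n h act) : (isotopeFunctor h hact).Full where
  map_surjective {B C} f := by
    obtain ⟨⟨α, β⟩, hB⟩ := B.exists_rep
    obtain ⟨⟨γ, δ⟩, hC⟩ := C.exists_rep
    obtain ⟨g, hg⟩ := f
    obtain ⟨φ, rfl⟩ := QuotientGroup.mk_surjective g
    have hg' : act.smul (φ : PG n h) B.toXSet = C.toXSet := hg
    rw [B.toXSet_eq h hB, C.toXSet_eq h hC, hact.smul_mk_eq_iff] at hg'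
    obtain ⟨c, hc⟩ := hg'
    -- `φ` respects the products up to `c`; in `cφ` the left side acquires a second `c`, matching
    -- the `c²` on the right.
    let ψ : B ⟶ C := ⟨DistribMulAction.toModuleAut k A c * φ, fun x y => by
      change (c : k) • (φ : A ≃ₗ[k] A) (B.mul x y) =
        C.mul ((c : k) • (φ : A ≃ₗ[k] A) x) ((c : k) • (φ : A ≃ₗ[k] A) y)
      rw [hB, hc, map_smul, LinearMap.map_smul₂, hC]⟩
    refine ⟨ψ, Subtype.ext ?_⟩
    exact ((PG.mk_eq_mk_iff h).mpr ⟨c, fun x => rfl⟩).symm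

instance isotopeFunctor_essSurj (h : IsHurwitz n) [act : MulAction (PG n h) (XSet k A)]
    (hact : IsTrialityAction n h act) : (isotopeFunctor h hact).EssSurj where
  mem_essImage X := by
    obtain ⟨⟨⟩, x⟩ := X
    obtain ⟨⟨α, β⟩, rfl⟩ := XSet.exists_rep x
    refine ⟨isotope α β, ⟨eqToIso ?_⟩⟩
    have h1 : (isotope α β).toXSet = XSet.mk α β := (isotope α β).toXSet_eq h fun _ _ => rfl
    exact congrArg (fun y => (⟨(), y⟩ : ActionCategory (PG n h) (XSet k A))) h1

end Equivalence

end HurwitzIsotope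

open HurwitzIsotope CategoryTheory in
theorem theorem2p7 {k : Type*} {A : Type*} [Field k] [NonAssocRing A] [Module k A]
    [SMulCommClass k A A] [IsScalarTower k A A] [FiniteDimensional k A]
    (n : QuadraticForm k A) (h : IsHurwitz n) :
    ∃ act : MulAction (PG n h) (XSet k A), IsTrialityAction n h act ∧
      ∃ F : PrincipalIsotope k A ⥤ ActionCategory (PG n h) (XSet k A),
        F.IsEquivalence ∧
        (∀ α β : A ≃ₗ[k] A, (F.obj (isotope α β)).back = XSet.mk α β) ∧
        (∀ (B C : PrincipalIsotope k A) (f : B ⟶ C), ∃ hf : f.toLinearEquiv ∈ G n h,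
          ((F.map f).val : PG n h) = ((⟨f.toLinearEquiv, hf⟩ : G n h) : PG n h)) := by
  obtain ⟨act, hact⟩ := exists_trialityAction h
  exact ⟨act, hact, isotopeFunctor h hact, {},
    fun α β => (isotope α β).toXSet_eq h fun _ _ => rfl, fun B C f => ⟨f.mem_G h, rfl⟩⟩
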